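/- Let $M\ge 2$ and consider a continuous-variable system of $M$ modes with Hilbert space $L^2(\mathbb{R}^M)$, annihilation operators $a_m=(x_m+\partial_{x_m})/\sqrt2$ (closures of their restrictions to Schwartz functions), displacement operators $D(\vec\alpha)=\exp\bigl(\sum_m(\alpha_m a_m^\dagger-\alpha_m^* a_m)\bigr)$ for $\vec\alpha\in\mathbb{C}^M$, parity operator $\Pi=\exp\bigl(-i\pi\sum_m a_m^\dagger a_m\bigr)$, i.e. $(\Pi\psi)(x)=\psi(-x)$, and displaced parity operators $\Pi(\vec\alpha)=D(\vec\alpha)\,\Pi\,D(\vec\alpha)^\dagger$. A state is a positive operator of trace one. A state $\rho$ is genuinely multipartite entangled (GME) if it is not of the form $\rho=\sum_k p_k\,\rho_{A_k}\otimes\rho_{\bar A_k}$ (a finite or countable sum), where $p_k\ge 0$, $\sum_k p_k=1$, each $(A_k|\bar A_k)$ is a bipartition of the $M$ modes into two nonempty sets, and $\rho_{A_k}$, $\rho_{\bar A_k}$ are states of the modes in $A_k$ and in $\bar A_k$ respectively. Let $\rho$ be a state whose total energy satisfies $\sum_{m=1}^M \operatorname{tr}[\rho\,a_m^\dagger a_m]\le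 E$ with $0\le E<\infty$. Let $\Delta>0$ be a grid spacing, let $\mathcal S\subseteq\mathbb{Z}^2$, let $\vec 1=(1,\dots,1)\in\mathbb{C}^M$, and define (with values in $[0,\infty]$) $$I(\rho,\Delta;\mathcal S)=\sum_{(n_R,n_I)\in\mathcal S}\Delta^2\,\bigl|\operatorname{tr}\bigl[\rho\,\Pi\bigl((n_R+i n_I)\Delta\,\vec 1\bigr)\bigr]\bigr|,$$ $$\delta I(\Delta;\mathcal S,E)=\sum_{(n_R,n_I)\in\mathcal S}\Bigl[2\Delta^3\sqrt{2ME}+2M\Delta^4\Bigl(1+\sqrt{2(n_R^2+n_I^2)}\Bigr)\Bigr].$$ If $\delta I(\Delta;\mathcal S,E)<\infty$ (equivalently, $\mathcal S$ is finite) and $$I(\rho,\Delta;\mathcal S)-\delta I(\Delta;\mathcal S,E)>\frac{\pi}{4\sqrt{M-1}},$$ then $\rho$ is GME. -/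

import Mathlib

open MeasureTheory
open scoped ENNReal InnerProductSpace ComplexConjugate

noncomputable section

namespace CVSystem

/-! ### Trace and states on a Hilbert space -/

section Hilbert

variable {H : Type} [NormedAddCommGroup H] [InnerProductSpace ℂ H] [CompleteSpace H]

variable (H) in
/-- A fixed orthonormal basis of the Hilbert space; none of the notions below depends on
which one it is. -/
def basis : HilbertBasis (exists_hilbertBasis ℂ H).choose ℂ H :=
  (exists_hilbertBasis ℂ H).choose_spec.choose

/-- The trace `∑ᵢ ⟨eᵢ, T eᵢ⟩` (of trace class operators). -/
def trace (T : H →L[ℂ] H) : ℂ := ∑' i, ⟪basis H i, T (basis H i)⟫_ℂ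

/-- Density operators: positive operators with trace one. -/
def IsState (ρ : H →L[ℂ] H) : Prop := ρ.IsPositive ∧ trace ρ = 1

/-- The positive square root of a positive operator. -/
def sqrtOp (ρ : H →L[ℂ] H) : H →L[ℂ] H := CFC.sqrt ρ

end Hilbert

/-! ### Continuous-variable systems in the Schroedinger representation -/

/-- Configuration (position) space of the modes `ι`. -/
abbrev Config (ι : Type) : Type := ι → ℝ

/-- The Hilbert space `L²(ℝ^ι; ℂ)` of a system with a finite set `ι` of modes. -/
abbrev Space (ι : Type) [Fintype ι] : Type := Lp ℂ 2 (volume : Measure (Config ι))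

/-- Bounded operators on the Hilbert space of the modes `ι`. -/
abbrev Op (ι : Type) [Fintype ι] : Type := Space ι →L[ℂ] Space ι

section Operators

variable {ι : Type} [Fintype ι]

/-- The differential expression of the annihilation operator of mode `m`,
`a_m = (x_m + ∂/∂x_m) / √2`. -/
def annihilationExpr [DecidableEq ι] (m : ι) (η : Config ι → ℂ) (x : Config ι) : ℂ :=
  ((x m : ℂ) * η x + fderiv ℝ η x (Pi.single m 1)) / (Real.sqrt 2 : ℂ)

/-- The graph of `a_m` restricted to Schwartz functions. -/
def annihilationCore [DecidableEq ι] (m : ι) : Set (Space ι × Space ι) :=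
  {ψφ | ∃ η : SchwartzMap (Config ι) ℂ,
    (ψφ.1 : Config ι → ℂ) =ᵐ[volume] η ∧
    (ψφ.2 : Config ι → ℂ) =ᵐ[volume] annihilationExpr m η}

/-- The graph of the annihilation operator `a_m`, the closure of its restriction to
Schwartz functions: `(ψ, φ)` belongs to it iff `ψ` is in the domain of `a_m` and `a_m ψ = φ`. -/
def annihilationGraph [DecidableEq ι] (m : ι) : Set (Space ι × Space ι) :=
  closure (annihilationCore m)

/-- `⟨ψ, a_m† a_m ψ⟩ = ‖a_m ψ‖²`, which is `∞` if `ψ` is not in the domain of `a_m`. -/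
def numberForm [DecidableEq ι] (m : ι) (ψ : Space ι) : ℝ≥0∞ :=
  ⨅ (φ : Space ι) (_ : (ψ, φ) ∈ annihilationGraph m), ‖φ‖ₑ ^ 2

/-- The phase factor `exp (i ∑ₘ (√2 Im αₘ xₘ - Re αₘ Im αₘ))`. -/
def displacementPhase (α : ι → ℂ) (x : Config ι) : ℂ :=
  Complex.exp (Complex.I *
    ((∑ m, (Real.sqrt 2 * (α m).im * x m - (α m).re * (α m).im) : ℝ) : ℂ))

/-- The displacement of positions by `√2 Re α`. -/
def displacementShift (α : ι → ℂ) : Config ι := fun m => Real.sqrt 2 * (α m).re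

lemma norm_displacementPhase (α : ι → ℂ) (x : Config ι) : ‖displacementPhase α x‖ = 1 := by
  rw [displacementPhase, mul_comm, Complex.norm_exp_ofReal_mul_I]

lemma continuous_displacementPhase (α : ι → ℂ) : Continuous (displacementPhase α) := by
  unfold displacementPhase
  fun_prop

lemma measurePreserving_shift (v : Config ι) :
    MeasurePreserving (fun x : Config ι => x - v) volume volume :=
  measurePreserving_sub_right volume v

/-- Multiplication of a wave function by the phase factor. -/
def phaseOp (α : ι → ℂ) : Op ι :=
  LinearMap.mkContinuous
    { toFun := fun ψ => MemLp.toLp (fun x => displacementPhase α x * ψ x)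
        ((Lp.memLp ψ).of_le
          ((continuous_displacementPhase α).aestronglyMeasurable.mul
            (Lp.aestronglyMeasurable ψ))
          (Filter.Eventually.of_forall fun x => by
            rw [norm_mul, norm_displacementPhase, one_mul]))
      map_add' := fun ψ φ => by
        rw [← MemLp.toLp_add]
        refine MemLp.toLp_congr _ _ ?_
        filter_upwards [Lp.coeFn_add ψ φ] with x hx
        rw [Pi.add_apply]
        simp only [hx, Pi.add_apply, mul_add]
      map_smul' := fun c ψ => by
        rw [RingHom.id_apply, ← MemLp.toLp_const_smul]
        refine MemLp.toLp_congr _ _ ?_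
        filter_upwards [Lp.coeFn_smul c ψ] with x hx
        simp [hx, mul_left_comm] }
    1 (fun ψ => by
      rw [one_mul]
      refine Lp.norm_le_norm_of_ae_le ?_
      filter_upwards [MemLp.coeFn_toLp (p := 2) (μ := (volume : Measure (Config ι)))
        (f := fun x => displacementPhase α x * ψ x)
        ((Lp.memLp ψ).of_le
          ((continuous_displacementPhase α).aestronglyMeasurable.mul
            (Lp.aestronglyMeasurable ψ))
          (Filter.Eventually.of_forall fun x => by
            rw [norm_mul, norm_displacementPhase, one_mul]))] with x hx
      simp only [LinearMap.coe_mk, AddHom.coe_mk]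
      rw [hx, norm_mul, norm_displacementPhase, one_mul])

/-- Translation of a wave function, `ψ ↦ ψ (· - v)`. -/
def shiftOp (v : Config ι) : Op ι :=
  (Lp.compMeasurePreservingₗᵢ ℂ (fun x : Config ι => x - v)
    (measurePreserving_shift v)).toContinuousLinearMap

/-- The displacement operator `D(α) = exp (∑ₘ (αₘ aₘ† - conj αₘ aₘ))`, which in the
Schroedinger representation acts as
`(D(α) ψ)(x) = exp (i ∑ₘ (√2 Im αₘ xₘ - Re αₘ Im αₘ)) ψ(x - √2 Re α)`. -/
def displacement (α : ι → ℂ) : Op ι :=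
  phaseOp α ∘L shiftOp (displacementShift α)

/-- The displacement operator acts on wave functions as described. -/
lemma displacement_coeFn (α : ι → ℂ) (ψ : Space ι) :
    (displacement α ψ : Config ι → ℂ) =ᵐ[volume]
      fun x => displacementPhase α x * ψ (x - displacementShift α) := by
  have h1 := Lp.coeFn_compMeasurePreserving ψ (measurePreserving_shift (displacementShift α))
  have h2 := MemLp.coeFn_toLp
    ((Lp.memLp (shiftOp (displacementShift α) ψ)).of_le
      ((continuous_displacementPhase α).aestronglyMeasurable.mul
        (Lp.aestronglyMeasurable (shiftOp (displacementShift α) ψ)))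
      (Filter.Eventually.of_forall fun x => by
        rw [Pi.mul_apply, norm_mul, norm_displacementPhase, one_mul]))
  refine Filter.EventuallyEq.trans h2 ?_
  filter_upwards [h1] with x hx
  exact congrArg (displacementPhase α x * ·) hx

/-- The parity operator `Π = exp (-i π ∑ₘ aₘ† aₘ)`, which in the Schroedinger representation
acts as `(Π ψ)(x) = ψ(-x)`. -/
def parity (ι : Type) [Fintype ι] : Op ι :=
  (Lp.compMeasurePreservingₗᵢ ℂ (fun x : Config ι => -x)
    (Measure.measurePreserving_neg volume)).toContinuousLinearMap

/-- The displaced parity operator `Π(α) = D(α) Π D(α)†`. -/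
def displacedParity (α : ι → ℂ) : Op ι :=
  displacement α ∘L parity ι ∘L ContinuousLinearMap.adjoint (displacement α)

/-! ### Energy -/

/-- The mean excitation number `tr[ρ a_m† a_m] = tr[√ρ a_m† a_m √ρ] = ∑ᵢ ‖a_m √ρ eᵢ‖²`
of mode `m` in the state `ρ`, as an element of `[0, ∞]`. -/
def meanNumber [DecidableEq ι] (ρ : Op ι) (m : ι) : ℝ≥0∞ :=
  ∑' i, numberForm m (sqrtOp ρ (basis (Space ι) i))

/-- The total energy `∑ₘ tr[ρ a_m† a_m]`. -/
def totalEnergy [DecidableEq ι] (ρ : Op ι) : ℝ≥0∞ := ∑ m, meanNumber ρ m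

end Operators

/-! ### Genuine multipartite entanglement -/

section Entanglement

variable {ι : Type} [Fintype ι] [DecidableEq ι]

lemma memLp_prodFun (A : Finset ι) (u : Space {m // m ∈ A}) (v : Space {m // m ∉ A}) :
    MemLp (fun x : Config ι => u (fun m => x m) * v (fun m => x m)) 2 volume := by
  have hmp : MeasurePreserving (fun x : Config ι =>
      ((fun m => x m : Config {m // m ∈ A}), (fun m => x m : Config {m // m ∉ A})))
      volume ((volume : Measure (Config {m // m ∈ A})).prod volume) := by
    convert! volume_preserving_piEquivPiSubtypeProd (fun _ : ι => ℝ) (fun m => m ∈ A)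
    rw [Measure.volume_eq_prod]
    congr!
  have hprod : MemLp (fun z : Config {m // m ∈ A} × Config {m // m ∉ A} => u z.1 * v z.2) 2
      ((volume : Measure (Config {m // m ∈ A})).prod volume) := by
    refine (memLp_two_iff_integrable_sq_norm
      ((Lp.aestronglyMeasurable u).comp_fst.mul (Lp.aestronglyMeasurable v).comp_snd)).2 ?_
    simp only [Pi.mul_apply]
    simp only [norm_mul, mul_pow]
    exact Integrable.mul_prod
      ((memLp_two_iff_integrable_sq_norm (Lp.aestronglyMeasurable u)).1 (Lp.memLp u))
      ((memLp_two_iff_integrable_sq_norm (Lp.aestronglyMeasurable v)).1 (Lp.memLp v))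
  exact hprod.comp_measurePreserving hmp

/-- The product wave function `(u ⊗ v)(x) = u(x_A) v(x_Ā)`. -/
def prodVec (A : Finset ι) (u : Space {m // m ∈ A}) (v : Space {m // m ∉ A}) : Space ι :=
  (memLp_prodFun A u v).toLp _

/-- `σ` is the operator `σA ⊗ σB` for the bipartition `(A | Ā)` of the modes. It is determined
by its action on product vectors, since these span a dense subspace. -/
def IsTensor (A : Finset ι) (σA : Op {m // m ∈ A}) (σB : Op {m // m ∉ A}) (σ : Op ι) : Prop :=
  ∀ u v, σ (prodVec A u v) = prodVec A (σA u) (σB v)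

/-- `σ = ρ_A ⊗ ρ_Ā` for some bipartition of the modes into two nonempty sets, and states
`ρ_A`, `ρ_Ā` of the two parts. -/
def IsProductState (σ : Op ι) : Prop :=
  ∃ A : Finset ι, A.Nonempty ∧ Aᶜ.Nonempty ∧
    ∃ (σA : Op {m // m ∈ A}) (σB : Op {m // m ∉ A}),
      IsState σA ∧ IsState σB ∧ IsTensor A σA σB σ

/-- `ρ` is a (finite or countable) statistical mixture of product states, each of them with
respect to a bipartition of its own. -/
def IsBiseparableMixture (ρ : Op ι) : Prop :=
  ∃ (p : ℕ → ℝ) (σ : ℕ → Op ι),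
    (∀ k, 0 ≤ p k) ∧ HasSum p 1 ∧ (∀ k, IsProductState (σ k)) ∧
      HasSum (fun k => (p k : ℂ) • σ k) ρ

/-- Genuine multipartite entanglement: `ρ` is a state that is not a mixture of states which
are products with respect to some bipartition. -/
def IsGME (ρ : Op ι) : Prop := IsState ρ ∧ ¬ IsBiseparableMixture ρ

end Entanglement

/-! ### The discretised integral and its error term -/

/-- The point `(n_R + i n_I) Δ (1, …, 1)` of the slice `α (1, …, 1)`. -/
def gridPoint (M : ℕ) (Δ : ℝ) (n : ℤ × ℤ) : Fin M → ℂ :=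
  fun _ => ((n.1 : ℂ) + Complex.I * (n.2 : ℂ)) * (Δ : ℂ)

/-- `I(ρ, Δ; S) = ∑_{n ∈ S} Δ² |tr[ρ Π((n_R + i n_I) Δ (1, …, 1))]|`, in `[0, ∞]`. -/
def discreteIntegral {M : ℕ} (ρ : Op (Fin M)) (Δ : ℝ) (S : Set (ℤ × ℤ)) : ℝ≥0∞ :=
  ∑' n : S, ENNReal.ofReal (Δ ^ 2 * ‖trace (ρ ∘L displacedParity (gridPoint M Δ n))‖)

/-- `δI(Δ; S, E) = ∑_{n ∈ S} [2 Δ³ √(2 M E) + 2 M Δ⁴ (1 + √(2 (n_R² + n_I²)))]`, in `[0, ∞]`;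
it is finite exactly if `S` is finite (for `Δ > 0` and `M > 0`). -/
def discreteError (M : ℕ) (Δ : ℝ) (S : Set (ℤ × ℤ)) (E : ℝ) : ℝ≥0∞ :=
  ∑' n : S, ENNReal.ofReal (2 * Δ ^ 3 * Real.sqrt (2 * M * E) +
    2 * M * Δ ^ 4 * (1 + Real.sqrt (2 * (((n : ℤ × ℤ).1 : ℝ) ^ 2 + ((n : ℤ × ℤ).2 : ℝ) ^ 2))))

end CVSystem

end

/-! Contraposition: if `ρ` is biseparable, the integral of `|tr[ρ Π(α (1, …, 1))]|` over the plane
of `α` is at most `π / (4 √(M - 1))`, and for any state within the energy bound the grid sum exceeds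
this integral by at most `δI`.

Integral bound. In a pure state `ψ` the expectation value of `Π(α)` is the unnormalised Wigner
function of `ψ`. On the slice, its dependence on `Im α` is a Fourier transform in the single
variable `∑ₘ yₘ`. A Plancherel argument followed by integration over `Re α` bounds the integral of
its square by `π / (4k) ‖ψ‖⁴` for `k` modes (`lintegral_wigner_sq_le`). For a product vector over
`(A | Ā)` the Wigner function factorises, so Cauchy-Schwarz gives `π / (4 √(k (M - k)))` with `k =
|A|`, and `k (M - k) ≥ M - 1` (`lintegral_wigner_prodVec_le`). A biseparable mixture decomposes into
product vectors whose squared norms sum to one, and the triangle inequality finishes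
(`IsBiseparableMixture.lintegral_trace_le`).

Discretisation. The derivative of `⟨ψ, Π(α) ψ⟩` in one mode, in direction `v`, consists of two terms
pairing `ψ` with `a_m ψ` and a term proportional to `Re (conj v αₘ)`. Hence it is at most `4 |v|
(‖ψ‖ ‖a_m ψ‖ + |αₘ| ‖ψ‖²)` (`norm_wigner_update_sub_le_schwartz`). Passing to the closure of `a_m`,
summing over modes and over an ensemble for `ρ` yields a Lipschitz bound in terms of the energy
(`norm_trace_displacedParity_sub_le`). Comparing each grid value with the values on its cell of area
`Δ²` gives exactly the error term (`discreteIntegral_le`).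

States are handled throughout as norm-convergent sums `∑ᵢ |ψᵢ⟩⟨ψᵢ|`, which reduces every trace to a
sum of expectation values in vectors. -/

noncomputable section

namespace CVSystem

/-! ### Ensembles of vectors -/

section Ensemble

variable {H : Type} [NormedAddCommGroup H] [InnerProductSpace ℂ H]

/-- The family `ψ` is square summable and `T = ∑ᵢ |ψᵢ⟩⟨ψᵢ|`. -/
def IsEnsemble {κ : Type} (T : H →L[ℂ] H) (ψ : κ → H) : Prop :=
  Summable (fun i => ‖ψ i‖ ^ 2) ∧ HasSum (fun i => InnerProductSpace.rankOne ℂ (ψ i) (ψ i)) T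

lemma hasSum_norm_inner_sq {w : Type} (b : HilbertBasis w ℂ H) (x : H) :
    HasSum (fun i => ‖⟪b i, x⟫_ℂ‖ ^ 2) (‖x‖ ^ 2) := by
  have h := b.hasSum_inner_mul_inner x x
  rw [inner_self_eq_norm_sq_to_K] at h
  have h2 := Complex.hasSum_re h
  convert h2 using 1
  · ext i
    rw [← inner_conj_symm x (b i), ← Complex.normSq_eq_conj_mul_self, Complex.ofReal_re,
      Complex.normSq_eq_norm_sq]
  · norm_cast

lemma IsEnsemble.hasSum_inner {κ : Type} {T : H →L[ℂ] H} {ψ : κ → H} (h : IsEnsemble T ψ)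
    (x y : H) : HasSum (fun i => ⟪x, ψ i⟫_ℂ * ⟪ψ i, y⟫_ℂ) ⟪x, T y⟫_ℂ := by
  have h1 := (h.2.mapL (ContinuousLinearMap.apply ℂ H y)).mapL (innerSL ℂ x)
  simpa [inner_smul_right, mul_comm] using h1

lemma summable_rankOne [CompleteSpace H] {κ : Type} {ψ : κ → H} (h : Summable (fun i => ‖ψ i‖ ^ 2)) :
    Summable (fun i => InnerProductSpace.rankOne ℂ (ψ i) (ψ i)) := by
  refine Summable.of_norm ?_
  simpa [← pow_two] using h

lemma isEnsemble_tsum [CompleteSpace H] {κ : Type} {ψ : κ → H}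
    (h : Summable (fun i => ‖ψ i‖ ^ 2)) :
    IsEnsemble (∑' i, InnerProductSpace.rankOne ℂ (ψ i) (ψ i)) ψ :=
  ⟨h, (summable_rankOne h).hasSum⟩

variable [CompleteSpace H]

/-- `tr[T B] = ∑ᵢ ⟨ψᵢ, B ψᵢ⟩` if `T = ∑ᵢ |ψᵢ⟩⟨ψᵢ|`. -/
lemma IsEnsemble.hasSum_trace_comp {κ : Type} {T : H →L[ℂ] H} {ψ : κ → H} (h : IsEnsemble T ψ)
    (B : H →L[ℂ] H) : HasSum (fun i => ⟪ψ i, B (ψ i)⟫_ℂ) (trace (T ∘L B)) := by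
  set e := basis H with he
  let f : κ × (exists_hilbertBasis ℂ H).choose → ℂ :=
    fun p => ⟪e p.2, ψ p.1⟫_ℂ * ⟪ψ p.1, B (e p.2)⟫_ℂ
  have hrow : ∀ i, HasSum (fun j => f (i, j)) ⟪ψ i, B (ψ i)⟫_ℂ := fun i => by
    have := e.hasSum_inner_mul_inner (ContinuousLinearMap.adjoint B (ψ i)) (ψ i)
    simp only [ContinuousLinearMap.adjoint_inner_left] at this
    simpa only [f, mul_comm] using this
  have hbound : ∀ i, HasSum
      (fun j => 2⁻¹ * (‖⟪e j, ψ i⟫_ℂ‖ ^ 2 + ‖⟪e j, ContinuousLinearMap.adjoint B (ψ i)⟫_ℂ‖ ^ 2))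
      (2⁻¹ * (‖ψ i‖ ^ 2 + ‖ContinuousLinearMap.adjoint B (ψ i)‖ ^ 2)) := fun i =>
    ((hasSum_norm_inner_sq e (ψ i)).add (hasSum_norm_inner_sq e _)).mul_left _
  -- Absolute summability justifies exchanging the two sums: AM-GM splits each term, and Parseval in
  -- `j` bounds the rows by a multiple of `‖ψ i‖ ^ 2`.
  have hsum : Summable f := by
    refine Summable.of_norm_bounded (g := fun p : κ × (exists_hilbertBasis ℂ H).choose =>
      2⁻¹ * (‖⟪e p.2, ψ p.1⟫_ℂ‖ ^ 2 +
        ‖⟪e p.2, ContinuousLinearMap.adjoint B (ψ p.1)⟫_ℂ‖ ^ 2)) ?_ ?_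
    · refine (summable_prod_of_nonneg fun p => by simp only [Pi.zero_apply]; positivity).2
        ⟨fun i => (hbound i).summable, ?_⟩
      simp only [fun i => (hbound i).tsum_eq]
      refine Summable.of_nonneg_of_le (fun i => by positivity) (fun i => ?_)
        (h.1.mul_left (2⁻¹ * (1 + ‖ContinuousLinearMap.adjoint B‖ ^ 2)))
      have := (ContinuousLinearMap.adjoint B).le_opNorm (ψ i)
      have h2 := pow_le_pow_left₀ (norm_nonneg _) this 2
      rw [mul_pow] at h2
      linarith
    · rintro ⟨i, j⟩
      simp only [f, norm_mul]
      rw [← ContinuousLinearMap.adjoint_inner_left B, norm_inner_symm _ (e j)]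
      nlinarith [sq_nonneg (‖⟪e j, ψ i⟫_ℂ‖ - ‖⟪e j, ContinuousLinearMap.adjoint B (ψ i)⟫_ℂ‖)]
  have hrows := hsum.hasSum.prod_fiberwise hrow
  have hcols : HasSum (fun j => ⟪e j, T (B (e j))⟫_ℂ) (∑' p, f p) := by
    have hswap := ((Equiv.prodComm _ _).hasSum_iff (f := f)).2 hsum.hasSum
    exact hswap.prod_fiberwise fun j => h.hasSum_inner (e j) (B (e j))
  have : trace (T ∘L B) = ∑' p, f p := hcols.tsum_eq
  rwa [this]

lemma IsEnsemble.hasSum_norm_sq {κ : Type} {T : H →L[ℂ] H} {ψ : κ → H} (h : IsEnsemble T ψ)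
    (hT : trace T = 1) : HasSum (fun i => ‖ψ i‖ ^ 2) 1 := by
  have h1 := Complex.hasSum_re (h.hasSum_trace_comp (ContinuousLinearMap.id ℂ H))
  simp only [ContinuousLinearMap.comp_id, ContinuousLinearMap.id_apply, hT, Complex.one_re,
    inner_self_eq_norm_sq_to_K] at h1
  convert h1 using 2
  norm_cast

lemma sqrtOp_comp_self {T : H →L[ℂ] H} (hT : T.IsPositive) (x y : H) :
    ⟪sqrtOp T x, sqrtOp T y⟫_ℂ = ⟪x, T y⟫_ℂ := by
  have h0 : (0 : H →L[ℂ] H) ≤ T := ContinuousLinearMap.nonneg_iff_isPositive T |>.2 hT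
  have h1 : sqrtOp T * sqrtOp T = T := CFC.sqrt_mul_sqrt_self T h0
  have h2 : IsSelfAdjoint (sqrtOp T) := (CFC.sqrt_nonneg T).isSelfAdjoint
  rw [← ContinuousLinearMap.adjoint_inner_right, h2.adjoint_eq,
    ← mul_apply_eq_comp, h1]

/-- A state is the ensemble of the vectors `√ρ eᵢ`. -/
lemma IsState.isEnsemble_sqrtOp {ρ : H →L[ℂ] H} (hρ : IsState ρ) :
    IsEnsemble ρ (fun i => sqrtOp ρ (basis H i)) := by
  have hs : Summable (fun i => ‖sqrtOp ρ (basis H i)‖ ^ 2) := by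
    have h1 : Summable (fun i => ⟪basis H i, ρ (basis H i)⟫_ℂ) := by
      -- A divergent `tsum` takes the default value `0`, so trace one already forces summability.
      by_contra hn
      have := hρ.2
      rw [trace, tsum_eq_zero_of_not_summable hn] at this
      exact zero_ne_one this
    refine (Complex.hasSum_re h1.hasSum).summable.congr fun i => ?_
    rw [← sqrtOp_comp_self hρ.1, inner_self_eq_norm_sq_to_K]
    norm_cast
  refine ⟨hs, ?_⟩
  convert! (summable_rankOne hs).hasSum
  refine ContinuousLinearMap.ext fun y => ext_inner_left ℂ fun x => ?_
  have h1 := (IsEnsemble.hasSum_inner ⟨hs, (summable_rankOne hs).hasSum⟩ x y)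
  refine HasSum.unique ?_ h1
  have h2 := (basis H).hasSum_inner_mul_inner (sqrtOp ρ x) (sqrtOp ρ y)
  rw [sqrtOp_comp_self hρ.1] at h2
  have h3 : IsSelfAdjoint (sqrtOp ρ) := (CFC.sqrt_nonneg ρ).isSelfAdjoint
  convert! h2 using 2 with i
  rw [← ContinuousLinearMap.adjoint_inner_right, ← ContinuousLinearMap.adjoint_inner_left,
    h3.adjoint_eq]

/-- A square summable family has only countably many nonzero members. Countability is needed later
to exchange the sum over the ensemble with the integral over the slice. -/
lemma IsEnsemble.exists_countable {κ : Type} {T : H →L[ℂ] H} {ψ : κ → H} (h : IsEnsemble T ψ) :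
    ∃ (κ' : Type) (_ : Countable κ') (φ : κ' → H), IsEnsemble T φ := by
  refine ⟨Function.support (fun i => ‖ψ i‖ ^ 2), h.1.countable_support.to_subtype,
    fun i => ψ i, h.1.subtype _, ?_⟩
  refine (hasSum_subtype_iff_of_support_subset (f := fun i =>
    InnerProductSpace.rankOne ℂ (ψ i) (ψ i)) (fun i hi => ?_)).2 h.2
  contrapose! hi
  simp only [Function.mem_support, ne_eq, not_not] at hi ⊢
  have : ψ i = 0 := by simpa using hi
  simp [this]

end Ensemble

/-! ### Displaced parity operators on wave functions -/

section Wigner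

variable {ι : Type} [Fintype ι]

/-- The phase factor `exp (2√2 i ∑ₘ Im αₘ yₘ)`. -/
def wignerPhase (α : ι → ℂ) (y : Config ι) : ℂ :=
  Complex.exp (Complex.I * ((2 * Real.sqrt 2 * ∑ m, (α m).im * y m : ℝ) : ℂ))

/-- The (unnormalized) Wigner function `∫ conj f(c + y) f(c - y) exp (2√2 i ∑ₘ Im αₘ yₘ) dy`,
where `c = √2 Re α`. -/
def wigner (α : ι → ℂ) (f : Config ι → ℂ) : ℂ :=
  ∫ y, conj (f (displacementShift α + y)) * f (displacementShift α - y) * wignerPhase α y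

lemma norm_wignerPhase (α : ι → ℂ) (y : Config ι) : ‖wignerPhase α y‖ = 1 := by
  rw [wignerPhase, mul_comm, Complex.norm_exp_ofReal_mul_I]

lemma continuous_wignerPhase (α : ι → ℂ) : Continuous (wignerPhase α) := by
  unfold wignerPhase
  fun_prop

lemma wigner_congr (α : ι → ℂ) {f g : Config ι → ℂ} (h : f =ᵐ[volume] g) :
    wigner α f = wigner α g := by
  refine integral_congr_ae ?_
  have h1 := (measurePreserving_add_left volume (displacementShift α)).quasiMeasurePreserving.ae_eq h
  have h2 := (Measure.measurePreserving_sub_left volume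
    (displacementShift α)).quasiMeasurePreserving.ae_eq h
  filter_upwards [h1, h2] with y h1 h2
  simp only [Function.comp_apply] at h1 h2
  rw [h1, h2]

lemma conj_displacementPhase_mul (α : ι → ℂ) (x : Config ι) :
    conj (displacementPhase α x) * displacementPhase α x = 1 := by
  rw [← Complex.normSq_eq_conj_mul_self, Complex.normSq_eq_norm_sq, norm_displacementPhase]
  simp

lemma inner_displacement (α : ι → ℂ) (ψ φ : Space ι) :
    ⟪displacement α ψ, displacement α φ⟫_ℂ = ⟪ψ, φ⟫_ℂ := by
  rw [L2.inner_def, L2.inner_def,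
    ← integral_sub_right_eq_self (fun x => ⟪ψ x, φ x⟫_ℂ) (displacementShift α)]
  refine integral_congr_ae ?_
  filter_upwards [displacement_coeFn α ψ, displacement_coeFn α φ] with x h1 h2
  rw [h1, h2]
  simp only [RCLike.inner_apply, map_mul]
  linear_combination (φ (x - displacementShift α) * conj (ψ (x - displacementShift α))) *
    conj_displacementPhase_mul α x

/-- The expectation value of a displaced parity operator as an integral. -/
lemma inner_displacedParity (α : ι → ℂ) (ψ : Space ι) :
    ⟪ψ, displacedParity α ψ⟫_ℂ = wigner α ψ := by
  set c := displacementShift α with hc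
  have hadd := measurePreserving_add_right (volume : Measure (Config ι)) c
  have hmem : MemLp (fun y => conj (displacementPhase α (y + c)) * ψ (y + c)) 2 volume := by
    refine ((Lp.memLp ψ).comp_measurePreserving hadd).of_le ?_ (Filter.Eventually.of_forall ?_)
    · refine AEStronglyMeasurable.mul ?_
        ((Lp.aestronglyMeasurable ψ).comp_measurePreserving hadd)
      have := continuous_displacementPhase α
      exact (Continuous.aestronglyMeasurable (by fun_prop))
    · intro x
      simp [norm_displacementPhase]
  -- The explicit candidate for `D(α)† ψ`. Since `D(α)` preserves inner products, `D(α) χ = ψ`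
  -- suffices to identify it.
  set χ : Space ι := hmem.toLp _ with hχ
  have hDχ : displacement α χ = ψ := by
    refine Lp.ext ?_
    have h2 := (measurePreserving_shift c).quasiMeasurePreserving.ae_eq hmem.coeFn_toLp
    filter_upwards [displacement_coeFn α χ, h2] with x h1 h2
    rw [h1]
    simp only [Function.comp_apply] at h2
    rw [h2, sub_add_cancel, ← mul_assoc, mul_comm (displacementPhase α x),
      conj_displacementPhase_mul, one_mul]
  have hadj : ContinuousLinearMap.adjoint (displacement α) ψ = χ := by
    refine ext_inner_left ℂ fun v => ?_
    rw [ContinuousLinearMap.adjoint_inner_right, ← hDχ, inner_displacement]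
  have h0 : ⟪ψ, displacedParity α ψ⟫_ℂ = ⟪χ, parity ι χ⟫_ℂ := by
    rw [← hadj, ContinuousLinearMap.adjoint_inner_left]
    rfl
  rw [h0, L2.inner_def, wigner]
  refine integral_congr_ae ?_
  have hpar := Lp.coeFn_compMeasurePreserving χ
    (Measure.measurePreserving_neg (volume : Measure (Config ι)))
  have h2 := (Measure.measurePreserving_neg
    (volume : Measure (Config ι))).quasiMeasurePreserving.ae_eq hmem.coeFn_toLp
  filter_upwards [hpar, h2, hmem.coeFn_toLp] with y h1 h2 h3
  have h4 : (parity ι χ) y = χ (-y) := h1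
  simp only [Function.comp_apply] at h2
  rw [h4, h2, h3]
  simp only [RCLike.inner_apply, map_mul, Complex.conj_conj]
  have h5 : displacementPhase α (y + c) * conj (displacementPhase α (-y + c)) =
      wignerPhase α y := by
    rw [displacementPhase, displacementPhase, wignerPhase, ← Complex.exp_conj, ← Complex.exp_add]
    congr 1
    simp only [map_mul, Complex.conj_I, Complex.conj_ofReal]
    rw [neg_mul, ← sub_eq_add_neg, ← mul_sub, ← Complex.ofReal_sub, ← Finset.sum_sub_distrib,
      Finset.mul_sum]
    congr 3
    ext m
    simp only [Pi.add_apply, Pi.neg_apply]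
    ring
  rw [← h5, add_comm y c, neg_add_eq_sub]
  ring

end Wigner

/-! ### Square integrals of Fourier transforms with Gaussian weights -/

/-- The Fourier transform `∫ exp (-ε b²) exp (2√2 i b t) db` of a Gaussian. -/
def gaussKernel (ε t : ℝ) : ℝ := Real.sqrt (Real.pi / ε) * Real.exp (-(2 / ε) * t ^ 2)

lemma gaussKernel_nonneg (ε t : ℝ) : 0 ≤ gaussKernel ε t := by
  unfold gaussKernel; positivity

@[fun_prop]
lemma measurable_gaussKernel (ε : ℝ) : Measurable (gaussKernel ε) := by
  unfold gaussKernel; fun_prop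

lemma gaussKernel_neg (ε t : ℝ) : gaussKernel ε (-t) = gaussKernel ε t := by
  simp [gaussKernel]

lemma integral_gaussian_mul_cexp {ε : ℝ} (hε : 0 < ε) (t : ℝ) :
    ∫ b : ℝ, Complex.exp (Complex.I * ((2 * Real.sqrt 2 * (b * t) : ℝ) : ℂ)) *
      (Real.exp (-ε * b ^ 2) : ℂ) = gaussKernel ε t := by
  have h := fourierIntegral_gaussian (b := (ε : ℂ)) (by simpa using hε)
    ((2 * Real.sqrt 2 * t : ℝ) : ℂ)
  have hs : (((Real.sqrt (Real.pi / ε) : ℝ)) : ℂ) = ((Real.pi : ℂ) / ε) ^ (1 / 2 : ℂ) := by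
    rw [Real.sqrt_eq_rpow, Complex.ofReal_cpow (by positivity)]
    push_cast
    rfl
  rw [gaussKernel, Complex.ofReal_mul, hs, Complex.ofReal_exp]
  have h9 : -(2 / ε) * t ^ 2 = -(2 * Real.sqrt 2 * t) ^ 2 / (4 * ε) := by
    have h8 : (Real.sqrt 2) ^ 2 = 2 := Real.sq_sqrt (by norm_num)
    rw [neg_mul, neg_div, mul_pow, mul_pow, h8]
    field_simp
    ring
  rw [h9]
  convert h using 3 with b
  · rw [mul_assoc]; push_cast; ring_nf
  · push_cast; ring_nf

/-- The total mass does not depend on `ε`, which is what allows the Gaussian weight to be removed in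
the end. -/
lemma lintegral_gaussKernel {ε : ℝ} (hε : 0 < ε) :
    ∫⁻ t, ENNReal.ofReal (gaussKernel ε t) = ENNReal.ofReal (Real.pi / Real.sqrt 2) := by
  unfold gaussKernel
  rw [← ofReal_integral_eq_lintegral_ofReal
    ((integrable_exp_neg_mul_sq (by positivity : 0 < 2 / ε)).const_mul _)
    (Filter.Eventually.of_forall fun t => by simp only [Pi.zero_apply]; positivity),
    integral_const_mul, integral_gaussian, ← Real.sqrt_mul (by positivity)]
  congr 1
  rw [show Real.pi / ε * (Real.pi / (2 / ε)) = Real.pi ^ 2 / 2 by field_simp,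
    Real.sqrt_div (by positivity), Real.sqrt_sq Real.pi_pos.le]

lemma lintegral_gaussKernel_sub_mul {ε : ℝ} (hε : 0 < ε) {r : ℝ} (hr : 0 < r) (t : ℝ) :
    ∫⁻ a, ENNReal.ofReal (gaussKernel ε (t - r * a)) =
      ENNReal.ofReal (Real.pi / Real.sqrt 2 / r) := by
  have hm : Measurable fun a => ENNReal.ofReal (gaussKernel ε a) :=
    (measurable_gaussKernel ε).ennreal_ofReal
  have h1 := lintegral_map (μ := (volume : Measure ℝ)) (f := fun a => ENNReal.ofReal
    (gaussKernel ε (t - a))) (g := fun a => r * a) (hm.comp (measurable_const_sub t))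
    (measurable_const_mul r)
  rw [Real.map_volume_mul_left hr.ne', lintegral_smul_measure] at h1
  rw [← h1, lintegral_sub_left_eq_self (fun a => ENNReal.ofReal (gaussKernel ε a)) t,
    lintegral_gaussKernel hε, abs_of_pos (inv_pos.2 hr), smul_eq_mul,
    ← ENNReal.ofReal_mul (by positivity)]
  congr 1
  ring

/-- Gaussian weighted square integrals of a Fourier transform. -/
lemma lintegral_gaussian_mul_sq_norm_le {X : Type*} [MeasurableSpace X] (μ : Measure X)
    [SFinite μ] {F : X → ℂ} (hF : Integrable F μ) {s : X → ℝ} (hs : Measurable s) {ε : ℝ}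
    (hε : 0 < ε) :
    ∫⁻ b, ENNReal.ofReal (Real.exp (-ε * b ^ 2)) *
        ‖∫ y, F y * Complex.exp (Complex.I * ((2 * Real.sqrt 2 * (b * s y) : ℝ) : ℂ)) ∂μ‖ₑ ^ 2 ≤
      ∫⁻ y, ∫⁻ y', ‖F y‖ₑ * ‖F y'‖ₑ * ENNReal.ofReal (gaussKernel ε (s y - s y')) ∂μ ∂μ := by
  let e : ℝ → ℝ → ℂ := fun b t => Complex.exp (Complex.I * ((2 * Real.sqrt 2 * (b * t) : ℝ) : ℂ))
  have hne : ∀ b t, ‖e b t‖ = 1 := fun b t => by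
    simp only [e]
    rw [mul_comm, Complex.norm_exp_ofReal_mul_I]
  have hce : Continuous fun p : ℝ × ℝ => e p.1 p.2 := by fun_prop
  -- The squared modulus is expanded into a double integral over `X × X`. The Gaussian weight makes
  -- it jointly integrable with `b`, so Fubini applies and the `b` integral produces the kernel.
  let G : ℝ → X × X → ℂ := fun b p =>
    (F p.1 * conj (F p.2)) * (e b (s p.1 - s p.2) * (Real.exp (-ε * b ^ 2) : ℂ))
  have hFF : Integrable (fun p : X × X => F p.1 * conj (F p.2)) (μ.prod μ) :=
    hF.mul_prod ((Complex.conjLIE.toContinuousLinearEquiv.toContinuousLinearMap).integrable_comp hF)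
  have hgauss : Integrable (fun b : ℝ => (Real.exp (-ε * b ^ 2) : ℂ)) :=
    (integrable_exp_neg_mul_sq hε).ofReal
  have hsm : Measurable fun p : X × X => s p.1 - s p.2 :=
    (hs.comp measurable_fst).sub (hs.comp measurable_snd)
  have hG : Integrable (Function.uncurry G) (volume.prod (μ.prod μ)) := by
    have h0 := hgauss.mul_prod hFF
    refine h0.mono ?_ (Filter.Eventually.of_forall ?_)
    · refine (hFF.aestronglyMeasurable.comp_snd).mul (AEStronglyMeasurable.mul ?_
        hgauss.aestronglyMeasurable.comp_fst)
      exact (hce.measurable.comp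
        (measurable_fst.prodMk (hsm.comp measurable_snd))).aestronglyMeasurable
    · rintro ⟨b, p⟩
      simp only [Function.uncurry, G, norm_mul, hne]
      apply le_of_eq; ring
  have hsq : ∀ b, ∫ p, G b p ∂(μ.prod μ) =
      ((Real.exp (-ε * b ^ 2) * ‖∫ y, F y * e b (s y) ∂μ‖ ^ 2 : ℝ) : ℂ) := fun b => by
    have h1 := integral_prod_mul (μ := μ) (ν := μ) (fun y => F y * e b (s y))
      (fun y => conj (F y * e b (s y)))
    rw [integral_conj, Complex.mul_conj, Complex.normSq_eq_norm_sq] at h1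
    rw [mul_comm, Complex.ofReal_mul, ← h1, ← integral_mul_const]
    refine integral_congr_ae (Filter.Eventually.of_forall fun p => ?_)
    have h2 : e b (s p.1 - s p.2) = e b (s p.1) * conj (e b (s p.2)) := by
      simp only [e, ← Complex.exp_conj, ← Complex.exp_add, map_mul, Complex.conj_I,
        Complex.conj_ofReal]
      congr 1
      push_cast
      ring
    simp only [G, h2, map_mul]
    ring
  have hker : ∀ p : X × X, ∫ b, G b p =
      (F p.1 * conj (F p.2)) * gaussKernel ε (s p.1 - s p.2) := fun p => by
    simp only [G]
    rw [integral_const_mul, integral_gaussian_mul_cexp hε]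
  have hint : Integrable fun b => Real.exp (-ε * b ^ 2) * ‖∫ y, F y * e b (s y) ∂μ‖ ^ 2 := by
    have := hG.integral_prod_left
    simp only [Function.uncurry_apply_pair, hsq] at this
    exact this.re
  calc _ = ∫⁻ b, ENNReal.ofReal (Real.exp (-ε * b ^ 2) * ‖∫ y, F y * e b (s y) ∂μ‖ ^ 2) := by
        refine lintegral_congr fun b => ?_
        rw [ENNReal.ofReal_mul (by positivity), ENNReal.ofReal_pow (norm_nonneg _),
          ofReal_norm]
    _ = ENNReal.ofReal (∫ b, Real.exp (-ε * b ^ 2) * ‖∫ y, F y * e b (s y) ∂μ‖ ^ 2) :=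
        (ofReal_integral_eq_lintegral_ofReal hint
          (Filter.Eventually.of_forall fun b => by simp only [Pi.zero_apply]; positivity)).symm
    _ ≤ ‖∫ b, ∫ p, G b p ∂(μ.prod μ)‖ₑ := by
        simp only [hsq]
        rw [integral_complex_ofReal, ← ofReal_norm, Complex.norm_real]
        exact ENNReal.ofReal_le_ofReal (le_abs_self _)
    _ = ‖∫ p, (∫ b, G b p) ∂(μ.prod μ)‖ₑ := by rw [integral_integral_swap hG]
    _ ≤ ∫⁻ p, ‖(F p.1 * conj (F p.2)) * gaussKernel ε (s p.1 - s p.2)‖ₑ ∂(μ.prod μ) := by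
        simp only [hker]
        exact enorm_integral_le_lintegral_enorm _
    _ = ∫⁻ p, ‖F p.1‖ₑ * ‖F p.2‖ₑ * ENNReal.ofReal (gaussKernel ε (s p.1 - s p.2))
          ∂(μ.prod μ) := by
        refine lintegral_congr fun p => ?_
        rw [enorm_mul, enorm_mul, ← ofReal_norm (gaussKernel _ _ : ℂ), Complex.norm_real,
          Real.norm_of_nonneg (gaussKernel_nonneg _ _), ← ofReal_norm (conj (F p.2)),
          RCLike.norm_conj, ofReal_norm]
    _ = _ := by
        refine lintegral_prod _ ?_
        have h1 := hF.aestronglyMeasurable.enorm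
        refine ((h1.comp_fst).mul h1.comp_snd).mul ?_
        exact ((measurable_gaussKernel ε).comp hsm).ennreal_ofReal.aemeasurable

/-! ### The purity bound on the slice `α (1, …, 1)` -/

lemma two_mul_mul_le_sq_add_sq (x y : ℝ≥0∞) : 2 * (x * y) ≤ x ^ 2 + y ^ 2 := by
  induction x with
  | top => simp
  | coe x =>
    induction y with
    | top => simp
    | coe y =>
      rw [← mul_assoc]
      exact_mod_cast two_mul_le_add_sq x y

section Slice

variable {κ : Type} [Fintype κ]

/-- The point `α (1, …, 1)`. -/
def diag (κ : Type) (p : ℝ × ℝ) : κ → ℂ := fun _ => ⟨p.1, p.2⟩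

lemma wigner_diag (p : ℝ × ℝ) (f : Config κ → ℂ) :
    wigner (diag κ p) f = ∫ y, conj (f (displacementShift (diag κ p) + y)) *
      f (displacementShift (diag κ p) - y) *
      Complex.exp (Complex.I * ((2 * Real.sqrt 2 * (p.2 * ∑ m, y m) : ℝ) : ℂ)) := by
  simp only [wigner, wignerPhase, diag, Finset.mul_sum]

lemma measurable_wigner_diag {f : Config κ → ℂ} (hf : Measurable f) :
    Measurable fun p : ℝ × ℝ => wigner (diag κ p) f := by
  have hc : Continuous fun q : (ℝ × ℝ) × Config κ => displacementShift (diag κ q.1) := by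
    unfold displacementShift diag
    fun_prop
  refine StronglyMeasurable.measurable (StronglyMeasurable.integral_prod_right
    (f := fun (p : ℝ × ℝ) (y : Config κ) => conj (f (displacementShift (diag κ p) + y)) *
      f (displacementShift (diag κ p) - y) * wignerPhase (diag κ p) y)
    (Measurable.stronglyMeasurable ?_))
  have h1 : Measurable fun q : (ℝ × ℝ) × Config κ =>
      f (displacementShift (diag κ q.1) + q.2) :=
    hf.comp (hc.add continuous_snd).measurable
  have h2 : Measurable fun q : (ℝ × ℝ) × Config κ =>
      f (displacementShift (diag κ q.1) - q.2) :=
    hf.comp (hc.sub continuous_snd).measurable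
  have h3 : Continuous fun q : (ℝ × ℝ) × Config κ => wignerPhase (diag κ q.1) q.2 := by
    unfold wignerPhase diag
    fun_prop
  exact ((Complex.continuous_conj.measurable.comp h1).mul h2).mul h3.measurable

lemma integrable_wigner {f : Config κ → ℂ} (hf : MemLp f 2 volume) (c : Config κ) :
    Integrable fun y => conj (f (c + y)) * f (c - y) :=
  MemLp.integrable_mul (p := 2) (q := 2)
    (hf.comp_measurePreserving (measurePreserving_add_left volume c)).star
    (hf.comp_measurePreserving (Measure.measurePreserving_sub_left volume c))

/-- For fixed `a = Re α`, the integral over `b = Im α` couples `y` and `y'` through a Gaussian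
kernel in `S y - S y'`. In the variables `x = c a + y`, `z = c a - y'` the kernel is centred at `S x
+ S z = r * a`, so the integral over `a` sees only its total mass and leaves the square of `∫ |f|²`.
The factor `1 / r` carries the number of modes. -/
lemma lintegral_gaussian_mul_wigner_sq_le [Nonempty κ] {f : Config κ → ℂ} (hf : Measurable f)
    (hf2 : MemLp f 2 volume) {ε : ℝ} (hε : 0 < ε) :
    ∫⁻ p : ℝ × ℝ, ENNReal.ofReal (Real.exp (-ε * p.2 ^ 2)) * ‖wigner (diag κ p) f‖ₑ ^ 2 ≤
      ENNReal.ofReal (Real.pi / (4 * Fintype.card κ)) * (∫⁻ y, ‖f y‖ₑ ^ 2) ^ 2 := by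
  set S : Config κ → ℝ := fun y => ∑ m, y m with hS
  have hSm : Measurable S := by fun_prop
  set A : Config κ → ℝ≥0∞ := fun y => ‖f y‖ₑ ^ 2 with hA
  have hAm : Measurable A := by fun_prop
  set c : ℝ → Config κ := fun a _ => Real.sqrt 2 * a with hc
  have hcm : Measurable c := by fun_prop
  set K : ℝ → ℝ≥0∞ := fun t => ENNReal.ofReal (gaussKernel ε t) with hK
  have hKm : Measurable K := (measurable_gaussKernel ε).ennreal_ofReal
  set r : ℝ := 2 * Real.sqrt 2 * Fintype.card κ with hr
  have hcard : (0 : ℝ) < Fintype.card κ := by exact_mod_cast Fintype.card_pos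
  have hr0 : 0 < r := by positivity
  have hSc : ∀ a, 2 * S (c a) = r * a := fun a => by
    simp only [hS, hc, hr, Finset.sum_const, Finset.card_univ, nsmul_eq_mul]
    ring
  have hstep : ∀ a : ℝ, ∫⁻ b : ℝ, ENNReal.ofReal (Real.exp (-ε * b ^ 2)) *
      ‖wigner (diag κ (a, b)) f‖ₑ ^ 2 ≤
      ∫⁻ x, ∫⁻ z, A x * A z * K (S x + S z - r * a) := fun a => by
    have h1 := lintegral_gaussian_mul_sq_norm_le volume (integrable_wigner hf2 (c a)) hSm hε
    have h0 : ∀ b, displacementShift (diag κ (a, b)) = c a := fun b => rfl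
    simp only [wigner_diag, h0]
    refine h1.trans ?_
    simp only [enorm_mul, RCLike.enorm_conj]
    have hcross : ∫⁻ y, ∫⁻ y', A (c a + y) * A (c a - y') * K (S y - S y') =
        ∫⁻ x, ∫⁻ z, A x * A z * K (S x + S z - r * a) := by
      symm
      rw [← lintegral_add_left_eq_self _ (c a)]
      refine lintegral_congr fun y => ?_
      rw [← lintegral_sub_left_eq_self _ (c a)]
      refine lintegral_congr fun y' => ?_
      have : S (c a + y) + S (c a - y') - r * a = S y - S y' := by
        rw [← hSc a]
        simp only [hS, Pi.add_apply, Pi.sub_apply, Finset.sum_add_distrib, Finset.sum_sub_distrib]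
        ring
      rw [this]
    have hcross' : ∫⁻ y, ∫⁻ y', A (c a - y) * A (c a + y') * K (S y - S y') =
        ∫⁻ x, ∫⁻ z, A x * A z * K (S x + S z - r * a) := by
      rw [← hcross, lintegral_lintegral_swap (by fun_prop)]
      refine lintegral_congr fun y => lintegral_congr fun y' => ?_
      rw [mul_comm (A (c a - y'))]
      simp only [hK]
      rw [← gaussKernel_neg, neg_sub]
    -- The four values of `f` are regrouped as `f (c a + y) f (c a - y')` times `f (c a - y) f (c a
    -- + y')`, and AM-GM is applied in doubled form. Both resulting squares have the same integral,
    -- because the kernel is even and `y`, `y'` can be swapped.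
    rw [← ENNReal.mul_le_mul_iff_right (a := 2) (by simp) (by simp),
      ← lintegral_const_mul _ (by fun_prop)]
    calc _ ≤ ∫⁻ y, ∫⁻ y', (A (c a + y) * A (c a - y') * K (S y - S y') +
            A (c a - y) * A (c a + y') * K (S y - S y')) := by
          refine lintegral_mono fun y => ?_
          rw [← lintegral_const_mul _ (by fun_prop)]
          refine lintegral_mono fun y' => ?_
          rw [← add_mul, ← mul_assoc]
          refine mul_le_mul_left ?_ _
          have := two_mul_mul_le_sq_add_sq (‖f (c a + y)‖ₑ * ‖f (c a - y')‖ₑ)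
            (‖f (c a - y)‖ₑ * ‖f (c a + y')‖ₑ)
          rw [mul_pow, mul_pow] at this
          refine le_trans (le_of_eq ?_) this
          ring
      _ = _ := by
          rw [two_mul, ← hcross]
          nth_rewrite 2 [hcross]
          rw [← hcross', ← lintegral_add_left (by fun_prop)]
          refine lintegral_congr fun y => ?_
          rw [← lintegral_add_left (by fun_prop)]
  have hm := measurable_wigner_diag hf
  rw [Measure.volume_eq_prod, lintegral_prod _ (by fun_prop)]
  calc _ ≤ ∫⁻ a : ℝ, ∫⁻ x, ∫⁻ z, A x * A z * K (S x + S z - r * a) := lintegral_mono hstep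
    _ = ∫⁻ x, ∫⁻ z, ∫⁻ a : ℝ, A x * A z * K (S x + S z - r * a) := by
        rw [lintegral_lintegral_swap (by fun_prop)]
        refine lintegral_congr fun x => ?_
        rw [lintegral_lintegral_swap (by fun_prop)]
    _ = ∫⁻ x, ∫⁻ z, A x * A z * ENNReal.ofReal (Real.pi / Real.sqrt 2 / r) := by
        refine lintegral_congr fun x => lintegral_congr fun z => ?_
        rw [lintegral_const_mul _ (by fun_prop), lintegral_gaussKernel_sub_mul hε hr0]
    _ = ENNReal.ofReal (Real.pi / Real.sqrt 2 / r) * (∫⁻ y, A y) ^ 2 := by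
        have : ∀ x, ∫⁻ z, A x * A z * ENNReal.ofReal (Real.pi / Real.sqrt 2 / r) =
            A x * ((∫⁻ y, A y) * ENNReal.ofReal (Real.pi / Real.sqrt 2 / r)) := fun x => by
          simp only [mul_assoc]
          rw [lintegral_const_mul _ (by fun_prop), lintegral_mul_const _ (by fun_prop)]
        simp only [this]
        rw [lintegral_mul_const _ (by fun_prop)]
        ring
    _ = _ := by
        congr 2
        have h8 : (Real.sqrt 2) * (Real.sqrt 2) = 2 := Real.mul_self_sqrt (by norm_num)
        rw [hr, div_div]
        congr 1
        linear_combination (2 * (Fintype.card κ : ℝ)) * h8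

/-- The integral of the squared Wigner function over the slice `α (1, …, 1)`. -/
lemma lintegral_wigner_sq_le [Nonempty κ] {f : Config κ → ℂ} (hf : Measurable f)
    (hf2 : MemLp f 2 volume) :
    ∫⁻ p : ℝ × ℝ, ‖wigner (diag κ p) f‖ₑ ^ 2 ≤
      ENNReal.ofReal (Real.pi / (4 * Fintype.card κ)) * (∫⁻ y, ‖f y‖ₑ ^ 2) ^ 2 := by
  have hm := measurable_wigner_diag hf
  let ε : ℕ → ℝ := fun n => 1 / ((n : ℝ) + 1)
  have hε : ∀ n, 0 < ε n := fun n => by positivity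
  have hlim : Filter.Tendsto ε Filter.atTop (nhds 0) := tendsto_one_div_add_atTop_nhds_zero_nat
  let G : ℕ → ℝ × ℝ → ℝ≥0∞ := fun n p =>
    ENNReal.ofReal (Real.exp (-ε n * p.2 ^ 2)) * ‖wigner (diag κ p) f‖ₑ ^ 2
  have hG : ∀ p, Filter.Tendsto (fun n => G n p) Filter.atTop
      (nhds (‖wigner (diag κ p) f‖ₑ ^ 2)) := fun p => by
    have h1 : Filter.Tendsto (fun n => ENNReal.ofReal (Real.exp (-ε n * p.2 ^ 2)))
        Filter.atTop (nhds 1) := by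
      have hc : Continuous fun t : ℝ => ENNReal.ofReal (Real.exp (-t * p.2 ^ 2)) :=
        ENNReal.continuous_ofReal.comp (by fun_prop)
      have h2 := (hc.tendsto 0).comp hlim
      simpa [Function.comp_def] using h2
    have h3 := ENNReal.Tendsto.mul_const (b := ‖wigner (diag κ p) f‖ₑ ^ 2) h1 (Or.inl one_ne_zero)
    rwa [one_mul] at h3
  -- Fatou's lemma, since the regularised bounds are uniform in `n`.
  calc _ = ∫⁻ p, Filter.liminf (fun n => G n p) Filter.atTop :=
        lintegral_congr fun p => (hG p).liminf_eq.symm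
    _ ≤ Filter.liminf (fun n => ∫⁻ p, G n p) Filter.atTop :=
        lintegral_liminf_le fun n => by fun_prop
    _ ≤ Filter.liminf (fun _ : ℕ => ENNReal.ofReal (Real.pi / (4 * Fintype.card κ)) *
          (∫⁻ y, ‖f y‖ₑ ^ 2) ^ 2) Filter.atTop :=
        Filter.liminf_le_liminf (Filter.Eventually.of_forall fun n =>
          lintegral_gaussian_mul_wigner_sq_le hf hf2 (hε n))
    _ = _ := Filter.liminf_const _

end Slice

/-! ### Product vectors -/

section Product

variable {ι : Type} [Fintype ι] [DecidableEq ι] (A : Finset ι)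

/-- The splitting of a configuration into the positions of the modes in `A` and in `Ā`. -/
def splitEquiv : Config ι ≃ᵐ Config {m // m ∈ A} × Config {m // m ∉ A} :=
  MeasurableEquiv.piEquivPiSubtypeProd (fun _ : ι => ℝ) (fun m => m ∈ A)

lemma splitEquiv_apply {κ : Type} [DecidableEq κ] (A : Finset κ) (x : Config κ) :
    splitEquiv A x = ((fun m => x m : Config {m // m ∈ A}), (fun m => x m : Config {m // m ∉ A})) :=
  rfl

lemma measurePreserving_splitEquiv : MeasurePreserving (splitEquiv A) volume volume := by
  convert! volume_preserving_piEquivPiSubtypeProd (fun _ : ι => ℝ) (fun m => m ∈ A)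

lemma prodVec_coeFn (u : Space {m // m ∈ A}) (v : Space {m // m ∉ A}) :
    (prodVec A u v : Config ι → ℂ) =ᵐ[volume]
      fun x => u (splitEquiv A x).1 * v (splitEquiv A x).2 :=
  MemLp.coeFn_toLp (memLp_prodFun A u v)

lemma integral_split_mul (g : Config {m // m ∈ A} → ℂ) (h : Config {m // m ∉ A} → ℂ) :
    ∫ x : Config ι, g (splitEquiv A x).1 * h (splitEquiv A x).2 = (∫ y, g y) * ∫ z, h z := by
  rw [(measurePreserving_splitEquiv A).integral_comp (splitEquiv A).measurableEmbedding
    (fun p => g p.1 * h p.2), Measure.volume_eq_prod, integral_prod_mul]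

lemma inner_prodVec (u u' : Space {m // m ∈ A}) (v v' : Space {m // m ∉ A}) :
    ⟪prodVec A u v, prodVec A u' v'⟫_ℂ = ⟪u, u'⟫_ℂ * ⟪v, v'⟫_ℂ := by
  rw [L2.inner_def, L2.inner_def, L2.inner_def, ← integral_split_mul]
  refine integral_congr_ae ?_
  filter_upwards [prodVec_coeFn A u v, prodVec_coeFn A u' v'] with x h1 h2
  simp only [h1, h2, RCLike.inner_apply, map_mul]
  ring

lemma norm_prodVec (u : Space {m // m ∈ A}) (v : Space {m // m ∉ A}) :
    ‖prodVec A u v‖ = ‖u‖ * ‖v‖ := by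
  have h := inner_prodVec A u u v v
  simp only [inner_self_eq_norm_sq_to_K] at h
  have h2 : ‖prodVec A u v‖ ^ 2 = (‖u‖ * ‖v‖) ^ 2 := by rw [mul_pow]; exact_mod_cast h
  exact (pow_left_inj₀ (norm_nonneg _) (by positivity) two_ne_zero).1 h2

lemma prodVec_smul (c : ℂ) (u : Space {m // m ∈ A}) (v : Space {m // m ∉ A}) :
    prodVec A (c • u) v = c • prodVec A u v := by
  refine Lp.ext ?_
  have h0 := ((measurePreserving_splitEquiv A).quasiMeasurePreserving).ae_eq_comp
    (Measure.quasiMeasurePreserving_fst.ae_eq_comp (Lp.coeFn_smul c u))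
  filter_upwards [prodVec_coeFn A (c • u) v, prodVec_coeFn A u v,
    Lp.coeFn_smul c (prodVec A u v), h0] with x h1 h2 h3 h4
  simp only [Function.comp_apply] at h4
  rw [h1, h3, Pi.smul_apply, h2, h4, Pi.smul_apply, smul_mul_assoc]

/-- Wigner functions of product vectors factorize. -/
lemma wigner_prodVec (α : ι → ℂ) (u : Space {m // m ∈ A}) (v : Space {m // m ∉ A}) :
    wigner α (prodVec A u v) = wigner (fun m : {m // m ∈ A} => α m) u *
      wigner (fun m : {m // m ∉ A} => α m) v := by
  rw [wigner_congr α (prodVec_coeFn A u v), wigner, wigner, wigner, ← integral_split_mul]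
  refine integral_congr_ae (Filter.Eventually.of_forall fun y => ?_)
  have h1 : wignerPhase α y = wignerPhase (fun m : {m // m ∈ A} => α m) (splitEquiv A y).1 *
      wignerPhase (fun m : {m // m ∉ A} => α m) (splitEquiv A y).2 := by
    simp only [wignerPhase, splitEquiv_apply, ← Complex.exp_add, ← mul_add, ← Complex.ofReal_add]
    rw [← Fintype.sum_subtype_add_sum_subtype (fun m => m ∈ A) (fun m => (α m).im * y m)]
    congr!
  have h2 : splitEquiv A (displacementShift α + y) =
    (displacementShift (fun m : {m // m ∈ A} => α m) + (splitEquiv A y).1,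
     displacementShift (fun m : {m // m ∉ A} => α m) + (splitEquiv A y).2) := rfl
  have h3 : splitEquiv A (displacementShift α - y) =
    (displacementShift (fun m : {m // m ∈ A} => α m) - (splitEquiv A y).1,
     displacementShift (fun m : {m // m ∉ A} => α m) - (splitEquiv A y).2) := rfl
  simp only [h1, h2, h3, map_mul]
  ring

lemma integrableOn_of_finite {ι : Type} [Fintype ι] (f : Space ι) {s : Set (Config ι)}
    (hμ : volume s < ∞) : IntegrableOn f s := by
  have : IsFiniteMeasure (volume.restrict s) := ⟨by simpa using hμ⟩
  exact ((Lp.memLp f).restrict s).integrable (by norm_num)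

lemma volume_preimage_splitEquiv_prod (s : Set (Config {m // m ∈ A}))
    (t : Set (Config {m // m ∉ A})) :
    volume (splitEquiv A ⁻¹' (s ×ˢ t)) = volume s * volume t := by
  rw [(measurePreserving_splitEquiv A).measure_preimage_equiv, Measure.volume_eq_prod,
    Measure.prod_prod]

/-- The indicator of a rectangle is itself a product vector when both sides have finite measure. -/
lemma setIntegral_split_eq_zero {f : Space ι} (hf : ∀ u v, ⟪prodVec A u v, f⟫_ℂ = 0)
    {s : Set (Config {m // m ∈ A})} {t : Set (Config {m // m ∉ A})} (hs : MeasurableSet s)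
    (ht : MeasurableSet t) (hμs : volume s ≠ ∞) (hμt : volume t ≠ ∞) :
    ∫ x in splitEquiv A ⁻¹' (s ×ˢ t), f x = 0 := by
  rw [← hf (indicatorConstLp 2 hs hμs 1) (indicatorConstLp 2 ht hμt 1), L2.inner_def,
    ← integral_indicator ((splitEquiv A).measurable (hs.prod ht))]
  refine integral_congr_ae ?_
  have h1 := ((measurePreserving_splitEquiv A).quasiMeasurePreserving).ae_eq_comp
    (Measure.quasiMeasurePreserving_fst.ae_eq_comp
      (indicatorConstLp_coeFn (p := 2) (hs := hs) (hμs := hμs) (c := (1 : ℂ))))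
  have h2 := ((measurePreserving_splitEquiv A).quasiMeasurePreserving).ae_eq_comp
    (Measure.quasiMeasurePreserving_snd.ae_eq_comp
      (indicatorConstLp_coeFn (p := 2) (hs := ht) (hμs := hμt) (c := (1 : ℂ))))
  filter_upwards [prodVec_coeFn A (indicatorConstLp 2 hs hμs 1) (indicatorConstLp 2 ht hμt 1),
    h1, h2] with x h0 h1 h2
  simp only [Function.comp_apply] at h1 h2
  rw [h0, h1, h2]
  by_cases hx1 : (splitEquiv A x).1 ∈ s <;> by_cases hx2 : (splitEquiv A x).2 ∈ t <;>
    simp [Set.indicator, hx1, hx2]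

/-- Only the zero vector is orthogonal to all product vectors. -/
lemma eq_zero_of_inner_prodVec {f : Space ι} (hf : ∀ u v, ⟪prodVec A u v, f⟫_ℂ = 0) : f = 0 := by
  let box : ℕ → Set (Config {m // m ∈ A} × Config {m // m ∉ A}) := fun n =>
    Metric.closedBall 0 n ×ˢ Metric.closedBall 0 n
  have hboxm : ∀ n, MeasurableSet (box n) := fun n =>
    measurableSet_closedBall.prod measurableSet_closedBall
  have hμ1 : ∀ n : ℕ, volume (Metric.closedBall (0 : Config {m // m ∈ A}) n) < ∞ :=
    fun n => measure_closedBall_lt_top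
  have hμ2 : ∀ n : ℕ, volume (Metric.closedBall (0 : Config {m // m ∉ A}) n) < ∞ :=
    fun n => measure_closedBall_lt_top
  have hboxμ : ∀ n, volume (splitEquiv A ⁻¹' box n) < ∞ := fun n => by
    rw [volume_preimage_splitEquiv_prod]
    exact ENNReal.mul_lt_top (hμ1 n) (hμ2 n)
  have hint : ∀ n, IntegrableOn f (splitEquiv A ⁻¹' box n) := fun n =>
    integrableOn_of_finite f (hboxμ n)
  -- A π-λ argument starting from rectangles. Intersecting with a box of finite measure keeps `f`
  -- integrable, and the vanishing integral over the whole box handles complements.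
  have key : ∀ n E, MeasurableSet E → ∫ x in splitEquiv A ⁻¹' (E ∩ box n), f x = 0 := by
    intro n E hE
    induction E, hE using MeasurableSpace.induction_on_inter generateFrom_prod.symm
      isPiSystem_prod with
    | empty => simp
    | basic E hE =>
      obtain ⟨s, hs : MeasurableSet s, t, ht : MeasurableSet t, rfl⟩ := hE
      rw [Set.prod_inter_prod]
      exact setIntegral_split_eq_zero A hf (hs.inter measurableSet_closedBall)
        (ht.inter measurableSet_closedBall)
        (measure_mono Set.inter_subset_right |>.trans_lt (hμ1 n)).ne
        (measure_mono Set.inter_subset_right |>.trans_lt (hμ2 n)).ne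
    | compl E hE ih =>
      have h1 := setIntegral_split_eq_zero A hf measurableSet_closedBall measurableSet_closedBall
        (hμ1 n).ne (hμ2 n).ne
      have h2 := integral_inter_add_sdiff (μ := volume) (f := f) (s := splitEquiv A ⁻¹' box n)
        ((splitEquiv A).measurable hE) (hint n)
      rw [← Set.preimage_inter, Set.inter_comm, ih, zero_add, ← Set.preimage_sdiff] at h2
      rw [Set.inter_comm, ← Set.sdiff_eq, h2]
      exact h1
    | iUnion g hd hm ih =>
      rw [Set.iUnion_inter, Set.preimage_iUnion, integral_iUnion
        (fun i => (splitEquiv A).measurable ((hm i).inter (hboxm n)))]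
      · simp only [ih, tsum_zero]
      · intro i j hij
        exact ((hd hij).mono Set.inter_subset_left Set.inter_subset_left).preimage _
      · exact (hint n).mono_set (by
          rw [← Set.preimage_iUnion, ← Set.iUnion_inter]
          exact Set.preimage_mono Set.inter_subset_right)
  refine Lp.ext ?_
  refine Filter.EventuallyEq.trans ?_ (Lp.coeFn_zero _ _ _).symm
  refine ae_eq_zero_of_forall_setIntegral_eq_of_sigmaFinite
    (fun s _ hs => integrableOn_of_finite f hs) fun s hs hμs => ?_
  let E : ℕ → Set (Config ι) := fun n => splitEquiv A ⁻¹' ((splitEquiv A).symm ⁻¹' s ∩ box n)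
  have hE0 : ∀ n, ∫ x in E n, f x = 0 := fun n => key n _ ((splitEquiv A).symm.measurable hs)
  have hEm : ∀ n, MeasurableSet (E n) := fun n =>
    (splitEquiv A).measurable (((splitEquiv A).symm.measurable hs).inter (hboxm n))
  have hmono : Monotone E := fun i j hij => Set.preimage_mono (Set.inter_subset_inter_right _
    (Set.prod_mono (Metric.closedBall_subset_closedBall (by exact_mod_cast hij))
      (Metric.closedBall_subset_closedBall (by exact_mod_cast hij))))
  have hU : ⋃ n, E n = s := by
    ext x
    simp only [E, Set.mem_iUnion, Set.mem_preimage, Set.mem_inter_iff,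
      MeasurableEquiv.symm_apply_apply]
    refine ⟨fun ⟨_, h, _⟩ => h, fun h => ?_⟩
    obtain ⟨n, hn⟩ := exists_nat_ge (max ‖(splitEquiv A x).1‖ ‖(splitEquiv A x).2‖)
    exact ⟨n, h, by simpa using (max_le_iff.1 hn).1, by simpa using (max_le_iff.1 hn).2⟩
  have hlim := tendsto_setIntegral_of_monotone (μ := volume) (f := f) hEm hmono
    (by rw [hU]; exact integrableOn_of_finite f hμs)
  rw [hU] at hlim
  simp only [hE0] at hlim
  exact (tendsto_nhds_unique hlim tendsto_const_nhds)

/-- An operator is determined by its matrix elements between product vectors. -/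
lemma op_ext_prodVec {S T : Op ι}
    (h : ∀ u v u' v', ⟪prodVec A u v, S (prodVec A u' v')⟫_ℂ =
      ⟪prodVec A u v, T (prodVec A u' v')⟫_ℂ) : S = T := by
  have h1 : ∀ u' v', S (prodVec A u' v') = T (prodVec A u' v') := fun u' v' =>
    sub_eq_zero.1 (eq_zero_of_inner_prodVec A fun u v => by rw [inner_sub_right, h, sub_self])
  refine ContinuousLinearMap.ext fun y => ext_inner_left ℂ fun x => ?_
  rw [← ContinuousLinearMap.adjoint_inner_left, ← ContinuousLinearMap.adjoint_inner_left]
  congr 1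
  refine sub_eq_zero.1 (eq_zero_of_inner_prodVec A fun u v => ?_)
  rw [inner_sub_right, ContinuousLinearMap.adjoint_inner_right,
    ContinuousLinearMap.adjoint_inner_right, h1, sub_self]

lemma summable_mul_prod_of_nonneg {κ κ' : Type} {f : κ → ℝ} {g : κ' → ℝ} (hf : Summable f)
    (hg : Summable g) (hf0 : ∀ i, 0 ≤ f i) (hg0 : ∀ i, 0 ≤ g i) :
    Summable (fun p : κ × κ' => f p.1 * g p.2) :=
  hf.mul_of_nonneg hg hf0 hg0

lemma hasSum_mul_prod {κ κ' : Type} {f : κ → ℂ} {g : κ' → ℂ} {a b : ℂ} (hf : HasSum f a)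
    (hg : HasSum g b) : HasSum (fun p : κ × κ' => f p.1 * g p.2) (a * b) :=
  hf.mul hg (summable_mul_of_summable_norm hf.summable.norm hg.summable.norm)

/-- The products of the two ensembles sum to some operator `T`. It has the same matrix elements
between product vectors as `σ`, and by density these determine an operator. -/
lemma IsTensor.isEnsemble {A : Finset ι} {κ κ' : Type} {σA : Op {m // m ∈ A}}
    {σB : Op {m // m ∉ A}} {σ : Op ι} (h : IsTensor A σA σB σ)
    {u : κ → Space {m // m ∈ A}} {v : κ' → Space {m // m ∉ A}} (hu : IsEnsemble σA u)
    (hv : IsEnsemble σB v) {w : κ × κ' → Space ι} (hw : ∀ p, w p = prodVec A (u p.1) (v p.2)) :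
    IsEnsemble σ w := by
  have hs : Summable (fun p => ‖w p‖ ^ 2) := by
    simp only [hw, norm_prodVec, mul_pow]
    exact summable_mul_prod_of_nonneg (f := fun i => ‖u i‖ ^ 2) (g := fun j => ‖v j‖ ^ 2)
      hu.1 hv.1 (fun _ => sq_nonneg _) (fun _ => sq_nonneg _)
  obtain ⟨T, hE⟩ : ∃ T, IsEnsemble T w := ⟨_, isEnsemble_tsum hs⟩
  have hσ : σ = T := by
    refine op_ext_prodVec A fun x y x' y' => ?_
    have h1 := hu.hasSum_inner x x'
    have h2 := hv.hasSum_inner y y'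
    have h3 := hasSum_mul_prod h1 h2
    have h4 := hE.hasSum_inner (prodVec A x y) (prodVec A x' y')
    rw [h, inner_prodVec]
    simp only [hw, inner_prodVec] at h4
    refine HasSum.unique (f := fun p : κ × κ' =>
      ⟪x, u p.1⟫_ℂ * ⟪u p.1, x'⟫_ℂ * (⟪y, v p.2⟫_ℂ * ⟪v p.2, y'⟫_ℂ)) h3 ?_
    convert! h4 using 2 with p
    ring
  rw [hσ]
  exact hE

/-- A biseparable mixture is an ensemble of product vectors. -/
lemma IsBiseparableMixture.exists_isEnsemble {ρ : Op ι} (h : IsBiseparableMixture ρ) :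
    ∃ (κ : Type) (_ : Countable κ) (A : κ → Finset ι) (u : ∀ i, Space {m // m ∈ A i})
      (v : ∀ i, Space {m // m ∉ A i}), (∀ i, (A i).Nonempty ∧ (A i)ᶜ.Nonempty) ∧
      IsEnsemble ρ (fun i => prodVec (A i) (u i) (v i)) := by
  obtain ⟨p, σ, hp, hp1, hσ, hρ⟩ := h
  choose A hA hAc σA σB hsA hsB ht using hσ
  choose κ hκ u hu using fun k => (hsA k).isEnsemble_sqrtOp.exists_countable
  choose κ' hκ' v hv using fun k => (hsB k).isEnsemble_sqrtOp.exists_countable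
  have hE : ∀ k, IsEnsemble (σ k) (fun q : κ k × κ' k => prodVec (A k) (u k q.1) (v k q.2)) :=
    fun k => (ht k).isEnsemble (hu k) (hv k) fun _ => rfl
  have hnorm : ∀ k (q : κ k × κ' k),
      ‖prodVec (A k) (((Real.sqrt (p k) : ℝ) : ℂ) • u k q.1) (v k q.2)‖ ^ 2 =
        p k * (‖u k q.1‖ ^ 2 * ‖v k q.2‖ ^ 2) := fun k q => by
    rw [norm_prodVec, norm_smul, Complex.norm_real, mul_pow, mul_pow, Real.norm_eq_abs, sq_abs,
      Real.sq_sqrt (hp k), mul_assoc]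
  have hrow : ∀ k, HasSum (fun q : κ k × κ' k => p k * (‖u k q.1‖ ^ 2 * ‖v k q.2‖ ^ 2)) (p k) :=
    fun k => by
    have h1 := (hu k).hasSum_norm_sq (hsA k).2
    have h2 := (hv k).hasSum_norm_sq (hsB k).2
    have h3 := (h1.mul h2 (summable_mul_prod_of_nonneg (f := fun i => ‖u k i‖ ^ 2)
      (g := fun j => ‖v k j‖ ^ 2) h1.summable h2.summable (fun _ => sq_nonneg _)
      (fun _ => sq_nonneg _))).mul_left (p k)
    simpa using h3
  have hs : Summable (fun i : (k : ℕ) × κ k × κ' k =>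
      ‖prodVec (A i.1) (((Real.sqrt (p i.1) : ℝ) : ℂ) • u i.1 i.2.1) (v i.1 i.2.2)‖ ^ 2) := by
    refine (summable_sigma_of_nonneg fun _ => by positivity).2 ⟨fun k => ?_, ?_⟩
    · simp only [hnorm]
      exact (hrow k).summable
    · simp only [hnorm, (hrow _).tsum_eq]
      exact hp1.summable
  -- The weight `p k` is absorbed as a factor `√(p k)` into the first tensor factor.
  refine ⟨(k : ℕ) × κ k × κ' k, inferInstance, fun i => A i.1,
    fun i => ((Real.sqrt (p i.1) : ℝ) : ℂ) • u i.1 i.2.1, fun i => v i.1 i.2.2,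
    fun i => ⟨hA i.1, hAc i.1⟩, hs, ?_⟩
  have hsum := (summable_rankOne hs).hasSum
  convert! hsum
  refine HasSum.unique hρ (hsum.sigma fun k => ?_)
  convert! (hE k).2.const_smul (p k : ℂ) using 2 with q
  rw [prodVec_smul, map_smulₛₗ, map_smulₛₗ]
  simp only [smul_apply, smul_smul, Complex.conj_ofReal, RingHom.id_apply]
  rw [← Complex.ofReal_mul, Real.mul_self_sqrt (hp k)]

end Product

/-! ### The slice integral of biseparable mixtures -/

section Biseparable

lemma lintegral_enorm_sq_eq {κ : Type} [Fintype κ] (u : Space κ) :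
    ∫⁻ y, ‖u y‖ₑ ^ 2 = ‖u‖ₑ ^ 2 := by
  have h := eLpNorm_nnreal_pow_eq_lintegral (μ := (volume : Measure (Config κ)))
    (f := (u : Config κ → ℂ)) (p := 2) two_ne_zero
  rw [Lp.enorm_def]
  simpa using h.symm

lemma lintegral_wigner_space_sq_le {κ : Type} [Fintype κ] [Nonempty κ] (u : Space κ) :
    ∫⁻ p : ℝ × ℝ, ‖wigner (diag κ p) u‖ₑ ^ 2 ≤
      ENNReal.ofReal (Real.pi / (4 * Fintype.card κ)) * (‖u‖ₑ ^ 2) ^ 2 := by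
  rw [← lintegral_enorm_sq_eq]
  exact lintegral_wigner_sq_le (Lp.stronglyMeasurable u).measurable (Lp.memLp u)

/-- Amounts to `k (M - k) - (M - 1) = (k - 1) (M - k - 1) ≥ 0`. The extremal case is one mode
against the rest. -/
lemma sqrt_card_mul_card_le {M k : ℕ} (hk : 1 ≤ k) (hkM : k + 1 ≤ M) :
    Real.pi / (4 * (k : ℝ)) * (Real.pi / (4 * ((M - k : ℕ) : ℝ))) ≤
      (Real.pi / (4 * Real.sqrt ((M : ℝ) - 1))) ^ 2 := by
  obtain ⟨l, rfl⟩ := Nat.exists_eq_add_of_le hkM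
  have h1 : (1 : ℝ) ≤ k := by exact_mod_cast hk
  have h2 : k + 1 + l - k = l + 1 := by omega
  have h3 : (0 : ℝ) ≤ l := by positivity
  rw [h2, div_mul_div_comm, div_pow, mul_pow, Real.sq_sqrt (by push_cast; linarith), ← pow_two]
  refine div_le_div_of_nonneg_left (by positivity) (by push_cast; nlinarith) ?_
  push_cast
  nlinarith

variable {ι : Type} [Fintype ι] [DecidableEq ι]

/-- On the slice both factors of the Wigner function are slice Wigner functions of their own modes
at the same `α`, so Cauchy-Schwarz separates them into the two square integrals already bounded. -/
lemma lintegral_wigner_prodVec_le {A : Finset ι} (hA : A.Nonempty) (hAc : Aᶜ.Nonempty)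
    (u : Space {m // m ∈ A}) (v : Space {m // m ∉ A}) :
    ∫⁻ p : ℝ × ℝ, ‖wigner (diag ι p) (prodVec A u v)‖ₑ ≤
      ENNReal.ofReal (Real.pi / (4 * Real.sqrt ((Fintype.card ι : ℝ) - 1))) *
        ‖prodVec A u v‖ₑ ^ 2 := by
  have hnA : Nonempty {m // m ∈ A} := hA.to_subtype
  have hnB : Nonempty {m // m ∉ A} := by
    obtain ⟨m, hm⟩ := hAc
    exact ⟨⟨m, Finset.mem_compl.1 hm⟩⟩
  have hmu : Measurable fun p => wigner (diag {m // m ∈ A} p) u :=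
    measurable_wigner_diag (Lp.stronglyMeasurable u).measurable
  have hmv : Measurable fun p => wigner (diag {m // m ∉ A} p) v :=
    measurable_wigner_diag (Lp.stronglyMeasurable v).measurable
  have hcardA : Fintype.card {m // m ∈ A} = A.card := Fintype.card_coe A
  have hcardB : Fintype.card {m // m ∉ A} = Fintype.card ι - A.card := by
    rw [Fintype.card_subtype_compl, hcardA]
  have hk : 1 ≤ A.card := hA.card_pos
  have hkM : A.card + 1 ≤ Fintype.card ι := by
    have := hAc.card_pos
    rw [Finset.card_compl] at this
    omega
  have hnorm : ‖prodVec A u v‖ₑ = ‖u‖ₑ * ‖v‖ₑ := by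
    rw [← ofReal_norm, norm_prodVec, ENNReal.ofReal_mul (norm_nonneg _), ofReal_norm, ofReal_norm]
  set Y : ℝ≥0∞ := ENNReal.ofReal (Real.pi / (4 * Real.sqrt ((Fintype.card ι : ℝ) - 1))) *
    (‖u‖ₑ ^ 2 * ‖v‖ₑ ^ 2)
  have hY : (∫⁻ p : ℝ × ℝ, ‖wigner (diag {m // m ∈ A} p) u‖ₑ ^ 2) *
      (∫⁻ p : ℝ × ℝ, ‖wigner (diag {m // m ∉ A} p) v‖ₑ ^ 2) ≤ Y ^ 2 := by
    refine (mul_le_mul' (lintegral_wigner_space_sq_le u) (lintegral_wigner_space_sq_le v)).trans ?_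
    rw [mul_mul_mul_comm, ← ENNReal.ofReal_mul (by positivity), hcardA, hcardB, ← mul_pow]
    simp only [Y]
    rw [mul_pow (ENNReal.ofReal _), ← ENNReal.ofReal_pow (by positivity)]
    exact mul_le_mul' (ENNReal.ofReal_le_ofReal (sqrt_card_mul_card_le hk hkM)) le_rfl
  have hholder := ENNReal.lintegral_mul_le_Lp_mul_Lq (volume : Measure (ℝ × ℝ))
    Real.HolderConjugate.two_two hmu.enorm.aemeasurable hmv.enorm.aemeasurable
  simp only [Pi.mul_apply, ENNReal.rpow_two] at hholder
  calc _ = ∫⁻ p : ℝ × ℝ, ‖wigner (diag {m // m ∈ A} p) u‖ₑ *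
        ‖wigner (diag {m // m ∉ A} p) v‖ₑ := by
        refine lintegral_congr fun p => ?_
        rw [wigner_prodVec, enorm_mul]
        rfl
    _ ≤ _ := hholder
    _ ≤ (Y ^ 2) ^ (1 / 2 : ℝ) := by
        rw [← ENNReal.mul_rpow_of_nonneg _ _ (by norm_num)]
        exact ENNReal.rpow_le_rpow hY (by norm_num)
    _ = Y := by
        rw [← ENNReal.rpow_two, ← ENNReal.rpow_mul]
        norm_num
    _ = _ := by rw [hnorm, mul_pow]

/-- The slice integral of a biseparable mixture is at most `π / (4 √(M - 1))`. -/
lemma IsBiseparableMixture.lintegral_trace_le {ρ : Op ι} (h : IsBiseparableMixture ρ)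
    (hρ : IsState ρ) :
    ∫⁻ p : ℝ × ℝ, ‖trace (ρ ∘L displacedParity (diag ι p))‖ₑ ≤
      ENNReal.ofReal (Real.pi / (4 * Real.sqrt ((Fintype.card ι : ℝ) - 1))) := by
  obtain ⟨κ, hκ, A, u, v, hA, hE⟩ := h.exists_isEnsemble
  have hnorm : ∑' i, ‖prodVec (A i) (u i) (v i)‖ₑ ^ 2 = 1 := by
    have h1 := hE.hasSum_norm_sq hρ.2
    have h2 := ENNReal.ofReal_tsum_of_nonneg (fun i => sq_nonneg _) h1.summable
    rw [h1.tsum_eq, ENNReal.ofReal_one] at h2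
    rw [h2]
    refine tsum_congr fun i => ?_
    rw [ENNReal.ofReal_pow (norm_nonneg _), ofReal_norm]
  calc _ ≤ ∫⁻ p : ℝ × ℝ, ∑' i, ‖wigner (diag ι p) (prodVec (A i) (u i) (v i))‖ₑ := by
        refine lintegral_mono fun p => ?_
        rw [← (hE.hasSum_trace_comp (displacedParity (diag ι p))).tsum_eq]
        simp only [inner_displacedParity]
        exact enorm_tsum_le_tsum_enorm
    _ = ∑' i, ∫⁻ p : ℝ × ℝ, ‖wigner (diag ι p) (prodVec (A i) (u i) (v i))‖ₑ :=
        lintegral_tsum fun i => (measurable_wigner_diag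
          (Lp.stronglyMeasurable (prodVec (A i) (u i) (v i))).measurable).enorm.aemeasurable
    _ ≤ ∑' i, ENNReal.ofReal (Real.pi / (4 * Real.sqrt ((Fintype.card ι : ℝ) - 1))) *
          ‖prodVec (A i) (u i) (v i)‖ₑ ^ 2 :=
        ENNReal.tsum_le_tsum fun i => lintegral_wigner_prodVec_le (hA i).1 (hA i).2 _ _
    _ = _ := by rw [ENNReal.tsum_mul_left, hnorm, mul_one]

end Biseparable

/-! ### Lipschitz bounds for Wigner functions -/

section Lipschitz

variable {ι : Type} [Fintype ι]

/-- The integrand of the polarized Wigner function. -/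
def crossKernel (p q : Config ι → ℂ) (α : ι → ℂ) (y : Config ι) : ℂ :=
  conj (p (displacementShift α + y)) * q (displacementShift α - y) * wignerPhase α y

lemma integrable_crossKernel {p q : Config ι → ℂ} (hp : MemLp p 2 volume) (hq : MemLp q 2 volume)
    (α : ι → ℂ) : Integrable (crossKernel p q α) := by
  have h : Integrable fun y => conj (p (displacementShift α + y)) *
      q (displacementShift α - y) := MemLp.integrable_mul (p := 2) (q := 2)
    (hp.comp_measurePreserving (measurePreserving_add_left volume _)).star
    (hq.comp_measurePreserving (Measure.measurePreserving_sub_left volume _))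
  refine h.mono (h.aestronglyMeasurable.mul
    (continuous_wignerPhase α).aestronglyMeasurable) (Filter.Eventually.of_forall fun y => ?_)
  rw [crossKernel, norm_mul _ (wignerPhase α y), norm_wignerPhase, mul_one]

/-- Cauchy-Schwarz: the phase is unimodular, and translation and reflection preserve the `L²` norms.
The bound is uniform in `α`. -/
lemma integral_norm_crossKernel_le {p q : Config ι → ℂ} (hp : MemLp p 2 volume)
    (hq : MemLp q 2 volume) (α : ι → ℂ) :
    ∫ y, ‖crossKernel p q α y‖ ≤
      (eLpNorm p 2 volume).toReal * (eLpNorm q 2 volume).toReal := by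
  set c := displacementShift α
  have hp' := hp.comp_measurePreserving (measurePreserving_add_left volume c)
  have hq' := hq.comp_measurePreserving (Measure.measurePreserving_sub_left volume c)
  have h1 := eLpNorm_smul_le_mul_eLpNorm (p := 2) (q := 2) (r := 1) hq'.1 hp'.star.1
  rw [eLpNorm_comp_measurePreserving hq.1 (Measure.measurePreserving_sub_left volume c),
    eLpNorm_star, eLpNorm_comp_measurePreserving hp.1 (measurePreserving_add_left volume c),
    eLpNorm_one_eq_lintegral_enorm] at h1
  rw [integral_norm_eq_lintegral_enorm (integrable_crossKernel hp hq α).1, ← ENNReal.toReal_mul]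
  refine ENNReal.toReal_mono (ENNReal.mul_ne_top hp.2.ne hq.2.ne) (le_trans (le_of_eq ?_) h1)
  refine lintegral_congr fun y => ?_
  have : ‖wignerPhase α y‖ₑ = 1 := by rw [← ofReal_norm, norm_wignerPhase, ENNReal.ofReal_one]
  rw [crossKernel, enorm_mul _ (wignerPhase α y), this, mul_one]
  rfl

lemma norm_integral_crossKernel_le {p q : Config ι → ℂ} (hp : MemLp p 2 volume)
    (hq : MemLp q 2 volume) (α : ι → ℂ) :
    ‖∫ y, crossKernel p q α y‖ ≤
      (eLpNorm p 2 volume).toReal * (eLpNorm q 2 volume).toReal :=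
  (norm_integral_le_integral_norm _).trans (integral_norm_crossKernel_le hp hq α)

lemma continuous_crossKernel {p q : Config ι → ℂ} (hp : Continuous p) (hq : Continuous q)
    {α : ℝ → ι → ℂ} (hα : Continuous α) :
    Continuous fun z : ℝ × Config ι => crossKernel p q (α z.1) z.2 := by
  have h1 : Continuous fun t => displacementShift (α t) := by
    unfold displacementShift
    fun_prop
  have h2 : Continuous fun z : ℝ × Config ι => wignerPhase (α z.1) z.2 := by
    unfold wignerPhase
    fun_prop
  exact ((Complex.continuous_conj.comp (hp.comp ((h1.comp continuous_fst).add
    continuous_snd))).mul (hq.comp ((h1.comp continuous_fst).sub continuous_snd))).mul h2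

lemma continuous_crossKernel_path {p q : Config ι → ℂ} (hp : Continuous p) (hq : Continuous q)
    {α : ℝ → ι → ℂ} (hα : Continuous α) (y : Config ι) :
    Continuous fun t => crossKernel p q (α t) y :=
  (continuous_crossKernel hp hq hα).comp (by fun_prop : Continuous fun t : ℝ => (t, y))

lemma integrable_prod_crossKernel {p q : Config ι → ℂ} (hp : Continuous p) (hq : Continuous q)
    (hp2 : MemLp p 2 volume) (hq2 : MemLp q 2 volume) {α : ℝ → ι → ℂ} (hα : Continuous α) :
    Integrable (Function.uncurry fun t y => crossKernel p q (α t) y)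
      ((volume.restrict (Set.uIoc (0 : ℝ) 1)).prod volume) := by
  have hm : AEStronglyMeasurable (Function.uncurry fun t y => crossKernel p q (α t) y)
      ((volume.restrict (Set.uIoc (0 : ℝ) 1)).prod (volume : Measure (Config ι))) :=
    (continuous_crossKernel hp hq hα).aestronglyMeasurable
  have hfin : IsFiniteMeasure (volume.restrict (Set.uIoc (0 : ℝ) 1)) :=
    ⟨by simp [Set.uIoc_of_le]⟩
  refine (integrable_prod_iff hm).2 ⟨Filter.Eventually.of_forall fun t =>
    integrable_crossKernel hp2 hq2 (α t), ?_⟩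
  refine Integrable.of_bound hm.norm.integral_prod_right'
    ((eLpNorm p 2 volume).toReal * (eLpNorm q 2 volume).toReal)
    (Filter.Eventually.of_forall fun t => ?_)
  rw [Real.norm_of_nonneg (integral_nonneg fun _ => norm_nonneg _)]
  exact integral_norm_crossKernel_le hp2 hq2 (α t)

/-- The derivative along a line of a product of two wave functions and a phase factor. -/
lemma hasDerivAt_mul_cexp {η : Config ι → ℂ} (hη : Differentiable ℝ η) {x₁ x₂ : ℝ → Config ι}
    {θ : ℝ → ℝ} {e : Config ι} {σ τ ω u : ℝ} (h1 : HasDerivAt x₁ (σ • e) u)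
    (h2 : HasDerivAt x₂ (τ • e) u) (h3 : HasDerivAt θ ω u) :
    HasDerivAt (fun u => conj (η (x₁ u)) * η (x₂ u) * Complex.exp (Complex.I * (θ u : ℂ)))
      ((σ * (conj (fderiv ℝ η (x₁ u) e) * η (x₂ u)) + τ * (conj (η (x₁ u)) * fderiv ℝ η (x₂ u) e)
        + Complex.I * ω * (conj (η (x₁ u)) * η (x₂ u))) *
          Complex.exp (Complex.I * (θ u : ℂ))) u := by
  have d1 : HasDerivAt (fun u => conj (η (x₁ u))) (conj (fderiv ℝ η (x₁ u) (σ • e))) u :=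
    (((hη (x₁ u)).hasFDerivAt.comp_hasDerivAt u h1)).star
  have d2 : HasDerivAt (fun u => η (x₂ u)) (fderiv ℝ η (x₂ u) (τ • e)) u :=
    ((hη (x₂ u)).hasFDerivAt.comp_hasDerivAt u h2)
  have d3 : HasDerivAt (fun u => Complex.exp (Complex.I * (θ u : ℂ)))
      (Complex.exp (Complex.I * (θ u : ℂ)) * (Complex.I * ω)) u :=
    ((h3.ofReal_comp).const_mul Complex.I).cexp
  convert! (d1.mul d2).mul d3 using 1
  simp only [map_smul, Complex.real_smul, map_mul, Complex.conj_ofReal, Pi.mul_apply]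
  ring

lemma integral_linear_combination {X : Type*} [MeasurableSpace X] {μ : Measure X}
    {f g h k : X → ℂ} (hf : Integrable f μ) (hg : Integrable g μ) (hh : Integrable h μ)
    (hk : Integrable k μ) (a b c d : ℂ) :
    ∫ y, (a * f y + b * g y - c * h y - d * k y) ∂μ =
      a * ∫ y, f y ∂μ + b * ∫ y, g y ∂μ - c * ∫ y, h y ∂μ - d * ∫ y, k y ∂μ := by
  have j1 : Integrable (fun y => a * f y + b * g y) μ := (hf.const_mul a).add (hg.const_mul b)
  have j2 : Integrable (fun y => a * f y + b * g y - c * h y) μ := j1.sub (hh.const_mul c)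
  rw [integral_sub j2 (hk.const_mul d), integral_sub j1 (hh.const_mul c),
    integral_add (hf.const_mul a) (hg.const_mul b)]
  simp only [integral_const_mul]

variable [DecidableEq ι]

/-- Multiplication by a position coordinate. -/
def posMul (m : ι) (η : Config ι → ℂ) (x : Config ι) : ℂ := (x m : ℂ) * η x

/-- The derivative in direction of a coordinate. -/
def partialDeriv (m : ι) (η : Config ι → ℂ) (x : Config ι) : ℂ :=
  fderiv ℝ η x (Pi.single m 1)

lemma displacementShift_update {κ : Type} [DecidableEq κ] (α : κ → ℂ) (m : κ) (z : ℂ) :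
    displacementShift (Function.update α m z) =
      displacementShift α + (Real.sqrt 2 * (z - α m).re) • (Pi.single m 1 : Config κ) := by
  ext k
  by_cases h : k = m
  · subst h
    simp [displacementShift]
    ring
  · simp [displacementShift, h]

lemma sum_update_im_mul (α : ι → ℂ) (m : ι) (z : ℂ) (y : Config ι) :
    ∑ k, (Function.update α m z k).im * y k = ∑ k, (α k).im * y k + (z - α m).im * y m := by
  rw [← sub_eq_iff_eq_add', ← Finset.sum_sub_distrib, Finset.sum_eq_single m]
  · simp; ring
  · intro k _ hk
    simp [hk]
  · simp

lemma hasDerivAt_crossKernel_update {η : Config ι → ℂ} (hη : Differentiable ℝ η) (α : ι → ℂ)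
    (m : ι) (v : ℂ) (y : Config ι) (t : ℝ) :
    HasDerivAt (fun t : ℝ => crossKernel η η (Function.update α m (α m + t * v)) y)
      (Real.sqrt 2 * v.re *
          (crossKernel (partialDeriv m η) η (Function.update α m (α m + t * v)) y +
            crossKernel η (partialDeriv m η) (Function.update α m (α m + t * v)) y) +
        Complex.I * Real.sqrt 2 * v.im *
          (crossKernel (posMul m η) η (Function.update α m (α m + t * v)) y -
            crossKernel η (posMul m η) (Function.update α m (α m + t * v)) y)) t := by
  set c := displacementShift α
  have hshift : ∀ t : ℝ, displacementShift (Function.update α m (α m + t * v)) =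
      c + (t * (Real.sqrt 2 * v.re)) • (Pi.single m 1 : Config ι) := fun t => by
    rw [displacementShift_update]
    congr 2
    simp
    ring
  have h0 : HasDerivAt (fun t : ℝ => c + (t * (Real.sqrt 2 * v.re)) • (Pi.single m 1 : Config ι))
      ((Real.sqrt 2 * v.re) • (Pi.single m 1 : Config ι)) t := by
    have := (((hasDerivAt_id t).mul_const (Real.sqrt 2 * v.re)).smul_const
      (Pi.single m 1 : Config ι)).const_add c
    simpa using this
  have h3 : HasDerivAt (fun t : ℝ => 2 * Real.sqrt 2 * (∑ k, (α k).im * y k + t * v.im * y m))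
      (2 * Real.sqrt 2 * (v.im * y m)) t := by
    have := ((((hasDerivAt_id t).mul_const v.im).mul_const (y m)).const_add
      (∑ k, (α k).im * y k)).const_mul (2 * Real.sqrt 2)
    simpa using this
  have hphase : ∀ t : ℝ, wignerPhase (Function.update α m (α m + t * v)) y = Complex.exp
      (Complex.I * ((2 * Real.sqrt 2 * (∑ k, (α k).im * y k + t * v.im * y m) : ℝ) : ℂ)) :=
    fun t => by
    rw [wignerPhase, sum_update_im_mul]
    simp
  convert hasDerivAt_mul_cexp hη (h0.add_const y) (h0.sub_const y) h3 using 1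
  · ext t
    rw [crossKernel, hshift, hphase]
  · simp only [crossKernel, hshift, hphase, partialDeriv, posMul, map_mul, Complex.conj_ofReal]
    set s := t * (Real.sqrt 2 * v.re)
    -- Differentiating the phase brings down `y m`, which is half the difference of the arguments of
    -- the two factors. This turns it into position operators acting on each factor.
    have hy : ((y m : ℝ) : ℂ) = (((c + s • (Pi.single m 1 : Config ι) + y) m : ℝ) -
        ((c + s • (Pi.single m 1 : Config ι) - y) m : ℝ)) / 2 := by
      simp only [Pi.add_apply, Pi.sub_apply]
      push_cast
      ring
    push_cast
    rw [hy]
    ring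

/-- A total derivative in `y` integrates to zero. This relation supplies the derivative terms needed
to assemble `a_m` from position and momentum. -/
lemma hasDerivAt_crossKernel_line {η : Config ι → ℂ} (hη : Differentiable ℝ η) (α : ι → ℂ)
    (m : ι) (y : Config ι) :
    HasLineDerivAt ℝ (crossKernel η η α)
      (crossKernel (partialDeriv m η) η α y - crossKernel η (partialDeriv m η) α y +
        Complex.I * (2 * Real.sqrt 2 * (α m).im) * crossKernel η η α y) y (Pi.single m 1) := by
  set c := displacementShift α
  have h0 : HasDerivAt (fun t : ℝ => y + t • (Pi.single m 1 : Config ι))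
      ((Pi.single m 1 : Config ι)) 0 := by
    have := ((hasDerivAt_id (0 : ℝ)).smul_const (Pi.single m 1 : Config ι)).const_add y
    simpa using this
  have h1 : HasDerivAt (fun t : ℝ => c + (y + t • (Pi.single m 1 : Config ι)))
      ((1 : ℝ) • (Pi.single m 1 : Config ι)) 0 := by
    rw [one_smul]; exact h0.const_add c
  have h2 : HasDerivAt (fun t : ℝ => c - (y + t • (Pi.single m 1 : Config ι)))
      ((-1 : ℝ) • (Pi.single m 1 : Config ι)) 0 := by
    rw [neg_one_smul]; exact h0.const_sub c
  have hsum : ∀ t : ℝ, ∑ k, (α k).im * (y + t • (Pi.single m 1 : Config ι)) k =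
      ∑ k, (α k).im * y k + t * (α m).im := fun t => by
    simp only [Pi.add_apply, Pi.smul_apply, mul_add, Finset.sum_add_distrib, smul_eq_mul]
    congr 1
    rw [Finset.sum_eq_single m]
    · simp; ring
    · intro k _ hk
      simp [hk]
    · simp
  have h3 : HasDerivAt (fun t : ℝ => 2 * Real.sqrt 2 *
      ∑ k, (α k).im * (y + t • (Pi.single m 1 : Config ι)) k)
      (2 * Real.sqrt 2 * (α m).im) 0 := by
    simp only [hsum]
    have := (((hasDerivAt_id (0 : ℝ)).mul_const (α m).im).const_add
      (∑ k, (α k).im * y k)).const_mul (2 * Real.sqrt 2)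
    simpa using this
  have h := hasDerivAt_mul_cexp hη h1 h2 h3
  simp only [zero_smul, add_zero] at h
  rw [HasLineDerivAt]
  convert! h using 1
  simp only [crossKernel, partialDeriv, wignerPhase]
  push_cast
  ring

lemma crossKernel_annihilationExpr_left (m : ι) (η q : Config ι → ℂ) (α : ι → ℂ)
    (y : Config ι) : Real.sqrt 2 * crossKernel (annihilationExpr m η) q α y =
      crossKernel (posMul m η) q α y + crossKernel (partialDeriv m η) q α y := by
  have h2 : ((Real.sqrt 2 : ℝ) : ℂ) ≠ 0 := by simp
  simp only [crossKernel, annihilationExpr, posMul, partialDeriv, map_div₀, map_add,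
    Complex.conj_ofReal]
  field_simp

lemma crossKernel_annihilationExpr_right (m : ι) (η p : Config ι → ℂ) (α : ι → ℂ)
    (y : Config ι) : Real.sqrt 2 * crossKernel p (annihilationExpr m η) α y =
      crossKernel p (posMul m η) α y + crossKernel p (partialDeriv m η) α y := by
  have h2 : ((Real.sqrt 2 : ℝ) : ℂ) ≠ 0 := by simp
  simp only [crossKernel, annihilationExpr, posMul, partialDeriv]
  field_simp

lemma crossKernel_posMul_add {κ : Type} [Fintype κ] (m : κ) (η : Config κ → ℂ) (α : κ → ℂ)
    (y : Config κ) :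
    crossKernel (posMul m η) η α y + crossKernel η (posMul m η) α y =
      2 * Real.sqrt 2 * (α m).re * crossKernel η η α y := by
  simp only [crossKernel, posMul, map_mul, Complex.conj_ofReal, Pi.add_apply, Pi.sub_apply,
    displacementShift]
  push_cast
  ring

/-- Wigner functions of Schwartz functions are Lipschitz in each of the modes. -/
lemma norm_wigner_update_sub_le_schwartz (η : SchwartzMap (Config ι) ℂ) (m : ι)
    (ha : MemLp (annihilationExpr m η) 2 volume) (α : ι → ℂ) (z : ℂ) {r : ℝ} (h1 : ‖α m‖ ≤ r)
    (h2 : ‖z‖ ≤ r) :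
    ‖wigner (Function.update α m z) η - wigner α η‖ ≤
      4 * ‖z - α m‖ * ((eLpNorm η 2 volume).toReal *
        (eLpNorm (annihilationExpr m η) 2 volume).toReal +
        r * (eLpNorm η 2 volume).toReal ^ 2) := by
  set v := z - α m with hv
  set N := (eLpNorm η 2 volume).toReal
  set X := (eLpNorm (annihilationExpr m η) 2 volume).toReal
  let β : ℝ → ι → ℂ := fun t => Function.update α m (α m + t * v)
  have hβ : Continuous β := by fun_prop
  have hηd : Differentiable ℝ η := η.differentiable
  have hηc : Continuous η := η.continuous
  have hη2 : MemLp η 2 volume := η.memLp 2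
  have hdη : partialDeriv m η = (LineDeriv.lineDerivOp (Pi.single m 1 : Config ι) η :
      SchwartzMap (Config ι) ℂ) := by
    ext x
    rw [SchwartzMap.lineDerivOp_apply_eq_fderiv]
    rfl
  have hdc : Continuous (partialDeriv m η) := hdη ▸ SchwartzMap.continuous _
  have hd2 : MemLp (partialDeriv m η) 2 volume := by
    rw [hdη]
    exact SchwartzMap.memLp _ 2 volume
  have hxc : Continuous (posMul m η) := by
    unfold posMul
    fun_prop
  have hx2 : MemLp (posMul m η) 2 volume := by
    have := (ha.const_mul (Real.sqrt 2 : ℂ)).sub hd2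
    convert! this using 1
    ext x
    have h2 : ((Real.sqrt 2 : ℝ) : ℂ) ≠ 0 := by simp
    simp only [posMul, annihilationExpr, partialDeriv, Pi.sub_apply]
    field_simp
    ring
  let D : ℝ → Config ι → ℂ := fun t y =>
    Real.sqrt 2 * v.re * (crossKernel (partialDeriv m η) η (β t) y +
      crossKernel η (partialDeriv m η) (β t) y) +
    Complex.I * Real.sqrt 2 * v.im * (crossKernel (posMul m η) η (β t) y -
      crossKernel η (posMul m η) (β t) y)
  let L : ℝ → Config ι → ℂ := fun t y =>
    crossKernel (partialDeriv m η) η (β t) y - crossKernel η (partialDeriv m η) (β t) y +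
      Complex.I * (2 * Real.sqrt 2 * (β t m).im) * crossKernel η η (β t) y
  have hLint : ∀ t, Integrable (L t) := fun t =>
    ((integrable_crossKernel hd2 hη2 _).sub (integrable_crossKernel hη2 hd2 _)).add
      ((integrable_crossKernel hη2 hη2 _).const_mul _)
  have hL0 : ∀ t, ∫ y, L t y = 0 := fun t => by
    have := integral_bilinear_hasLineDerivAt_right_eq_neg_left_of_integrable
      (μ := (volume : Measure (Config ι))) (B := ContinuousLinearMap.mul ℝ ℂ)
      (f := fun _ => 1) (f' := fun _ => 0) (g := crossKernel η η (β t)) (g' := L t)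
      (v := Pi.single m 1) (by simp) (by simpa using hLint t)
      (by simpa using integrable_crossKernel hη2 hη2 (β t))
      (fun x _ => (hasFDerivAt_const (1 : ℂ) x).hasLineDerivAt _)
      (fun y _ => hasDerivAt_crossKernel_line hηd (β t) m y)
    simpa using this
  have hDint : Integrable (Function.uncurry D)
      ((volume.restrict (Set.uIoc (0 : ℝ) 1)).prod volume) :=
    (((integrable_prod_crossKernel hdc hηc hd2 hη2 hβ).add
      (integrable_prod_crossKernel hηc hdc hη2 hd2 hβ)).const_mul _).add
    (((integrable_prod_crossKernel hxc hηc hx2 hη2 hβ).sub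
      (integrable_prod_crossKernel hηc hxc hη2 hx2 hβ)).const_mul _)
  have hDcont : ∀ y, Continuous fun t => D t y := fun y => by
    have c1 := continuous_crossKernel_path hdc hηc hβ y
    have c2 := continuous_crossKernel_path hηc hdc hβ y
    have c3 := continuous_crossKernel_path hxc hηc hβ y
    have c4 := continuous_crossKernel_path hηc hxc hβ y
    exact (continuous_const.mul (c1.add c2)).add (continuous_const.mul (c3.sub c4))
  -- The directional derivative in terms of `a_m`. The symmetric position terms reduce to `Re (β t
  -- m)` because the arguments of the two factors sum to twice the shift; the antisymmetric
  -- derivative terms reduce to `Im (β t m)` up to the total derivative `L`.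
  have hsplit : ∀ t y, D t y = 2 * v * crossKernel (annihilationExpr m η) η (β t) y +
      2 * conj v * crossKernel η (annihilationExpr m η) (β t) y -
      4 * (v.re * (β t m).re + v.im * (β t m).im) * crossKernel η η (β t) y -
      Complex.I * Real.sqrt 2 * v.im * L t y := fun t y => by
    have e1 := crossKernel_annihilationExpr_left m η η (β t) y
    have e2 := crossKernel_annihilationExpr_right m η η (β t) y
    have e3 := crossKernel_posMul_add m η (β t) y
    have e4 : ((Real.sqrt 2 : ℝ) : ℂ) * Real.sqrt 2 = 2 := by
      rw [← Complex.ofReal_mul, Real.mul_self_sqrt (by norm_num)]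
      norm_num
    have e5 : v = v.re + v.im * Complex.I := (Complex.re_add_im v).symm
    have e6 : conj v = v.re - v.im * Complex.I := by
      apply Complex.ext <;> simp
    simp only [D, L]
    linear_combination (-2 * crossKernel (annihilationExpr m η) η (β t) y) * e5 -
      2 * crossKernel η (annihilationExpr m η) (β t) y * e6 -
      (v.re + v.im * Complex.I) * Real.sqrt 2 * e1 - (v.re - v.im * Complex.I) * Real.sqrt 2 * e2 -
      Real.sqrt 2 * v.re * e3 +
      ((v.re + v.im * Complex.I) * crossKernel (annihilationExpr m η) η (β t) y +
        (v.re - v.im * Complex.I) * crossKernel η (annihilationExpr m η) (β t) y -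
        2 * v.re * (β t m).re * crossKernel η η (β t) y -
        2 * v.im * (β t m).im * crossKernel η η (β t) y) * e4 +
      2 * (Real.sqrt 2 : ℂ) ^ 2 * v.im * (β t m).im * crossKernel η η (β t) y * Complex.I_sq
  have hbound : ∀ t ∈ Set.uIoc (0 : ℝ) 1, ‖∫ y, D t y‖ ≤ 4 * ‖v‖ * (N * X + r * N ^ 2) := by
    intro t ht
    rw [Set.uIoc_of_le zero_le_one] at ht
    have hβm : ‖β t m‖ ≤ r := by
      have : β t m = ((1 - t : ℝ) : ℂ) * α m + (t : ℂ) * z := by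
        simp only [β, Function.update_self, hv]
        push_cast
        ring
      rw [this]
      refine (norm_add_le _ _).trans ?_
      rw [norm_mul, norm_mul, Complex.norm_real, Complex.norm_real,
        Real.norm_of_nonneg (by linarith [ht.2]), Real.norm_of_nonneg ht.1.le]
      nlinarith [ht.1, ht.2]
    have hdot : ‖(v.re * (β t m).re + v.im * (β t m).im : ℂ)‖ ≤ ‖v‖ * r := by
      have h5 : (v.re * (β t m).re + v.im * (β t m).im : ℂ) =
          (((conj v * β t m).re : ℝ) : ℂ) := by
        simp [Complex.mul_re]
      rw [h5, Complex.norm_real]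
      refine (Complex.abs_re_le_norm _).trans ?_
      rw [norm_mul, RCLike.norm_conj]
      gcongr
    have i1 := integrable_crossKernel ha hη2 (β t)
    have i2 := integrable_crossKernel hη2 ha (β t)
    have i3 := integrable_crossKernel hη2 hη2 (β t)
    have b1 := norm_integral_crossKernel_le ha hη2 (β t)
    have b2 := norm_integral_crossKernel_le hη2 ha (β t)
    have b3 := norm_integral_crossKernel_le hη2 hη2 (β t)
    simp only [hsplit]
    rw [integral_linear_combination i1 i2 i3 (hLint t), hL0, mul_zero, sub_zero]
    refine (norm_sub_le _ _).trans ((add_le_add_left (norm_add_le _ _) _).trans ?_)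
    simp only [norm_mul, RCLike.norm_conj, RCLike.norm_ofNat]
    have c1 := mul_le_mul_of_nonneg_left b1 (norm_nonneg v)
    have c2 := mul_le_mul_of_nonneg_left b2 (norm_nonneg v)
    have c3 := mul_le_mul hdot b3 (norm_nonneg _)
      (mul_nonneg (norm_nonneg v) ((norm_nonneg _).trans h1))
    simp only [N, X]
    linarith
  have hmain : wigner (Function.update α m z) η - wigner α η = ∫ t in (0 : ℝ)..1, ∫ y, D t y := by
    rw [intervalIntegral_integral_swap hDint]
    have h0 : β 0 = α := by simp [β]
    have h1' : β 1 = Function.update α m z := by simp [β, hv]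
    rw [← h1']
    nth_rewrite 1 [← h0]
    have : ∀ y, ∫ t in (0 : ℝ)..1, D t y = crossKernel η η (β 1) y - crossKernel η η (β 0) y :=
      fun y => intervalIntegral.integral_eq_sub_of_hasDerivAt
        (fun t _ => hasDerivAt_crossKernel_update hηd α m v y t)
        ((hDcont y).intervalIntegrable _ _)
    simp only [this]
    rw [integral_sub (integrable_crossKernel hη2 hη2 _) (integrable_crossKernel hη2 hη2 _)]
    rfl
  rw [hmain]
  simpa using intervalIntegral.norm_integral_le_of_norm_le_const hbound

end Lipschitz

/-! ### Energy bounds -/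

section Energy

/-- Both sides are continuous in `(ψ, φ)`, so a bound proved for Schwartz functions extends to the
whole graph of `a_m`. -/
lemma norm_inner_sub_le_of_mem_closure {H : Type} [NormedAddCommGroup H] [InnerProductSpace ℂ H]
    {s : Set (H × H)} (B C : H →L[ℂ] H) (c r : ℝ)
    (hs : ∀ ψ φ, (ψ, φ) ∈ s →
      ‖⟪ψ, B ψ⟫_ℂ - ⟪ψ, C ψ⟫_ℂ‖ ≤ c * (‖ψ‖ * ‖φ‖ + r * ‖ψ‖ ^ 2))
    {ψ φ : H} (h : (ψ, φ) ∈ closure s) :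
    ‖⟪ψ, B ψ⟫_ℂ - ⟪ψ, C ψ⟫_ℂ‖ ≤ c * (‖ψ‖ * ‖φ‖ + r * ‖ψ‖ ^ 2) := by
  have hT : IsClosed {q : H × H |
      ‖⟪q.1, B q.1⟫_ℂ - ⟪q.1, C q.1⟫_ℂ‖ ≤ c * (‖q.1‖ * ‖q.2‖ + r * ‖q.1‖ ^ 2)} :=
    isClosed_le (by fun_prop) (by fun_prop)
  exact closure_minimal (fun q hq => hs q.1 q.2 hq) hT h

variable {ι : Type} [Fintype ι] [DecidableEq ι]

lemma norm_inner_displacedParity_update_sub_le_of_core {ψ φ : Space ι} {m : ι}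
    {η : SchwartzMap (Config ι) ℂ} (hη : (ψ : Config ι → ℂ) =ᵐ[volume] η)
    (hφ : (φ : Config ι → ℂ) =ᵐ[volume] annihilationExpr m η) (α : ι → ℂ) (z : ℂ) {r : ℝ}
    (h1 : ‖α m‖ ≤ r) (h2 : ‖z‖ ≤ r) :
    ‖⟪ψ, displacedParity (Function.update α m z) ψ⟫_ℂ - ⟪ψ, displacedParity α ψ⟫_ℂ‖ ≤
      4 * ‖z - α m‖ * (‖ψ‖ * ‖φ‖ + r * ‖ψ‖ ^ 2) := by
  have ha : MemLp (annihilationExpr m η) 2 volume := (memLp_congr_ae hφ).1 (Lp.memLp φ)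
  have := norm_wigner_update_sub_le_schwartz η m ha α z h1 h2
  rw [inner_displacedParity, inner_displacedParity]
  rwa [← wigner_congr _ hη, ← wigner_congr _ hη, ← eLpNorm_congr_ae hη, ← eLpNorm_congr_ae hφ,
    ← Lp.norm_def, ← Lp.norm_def] at this

lemma norm_inner_displacedParity_update_sub_le {ψ φ : Space ι} {m : ι}
    (h : (ψ, φ) ∈ annihilationGraph m) (α : ι → ℂ) (z : ℂ) {r : ℝ} (h1 : ‖α m‖ ≤ r)
    (h2 : ‖z‖ ≤ r) :
    ‖⟪ψ, displacedParity (Function.update α m z) ψ⟫_ℂ - ⟪ψ, displacedParity α ψ⟫_ℂ‖ ≤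
      4 * ‖z - α m‖ * (‖ψ‖ * ‖φ‖ + r * ‖ψ‖ ^ 2) := by
  refine norm_inner_sub_le_of_mem_closure (displacedParity (Function.update α m z))
    (displacedParity α) (4 * ‖z - α m‖) r ?_ h
  rintro ψ φ ⟨η, hη, hφ⟩
  exact norm_inner_displacedParity_update_sub_le_of_core hη hφ α z h1 h2

/-- Young's inequality with a free parameter `s` replaces `‖ψ‖ ‖a_m ψ‖` by quantities that sum over
an ensemble to the trace and the mean excitation number. -/
lemma enorm_inner_displacedParity_update_sub_le (ψ : Space ι) (m : ι) (α : ι → ℂ) (z : ℂ)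
    {r d s : ℝ} (h1 : ‖α m‖ ≤ r) (h2 : ‖z‖ ≤ r) (hd : 0 < d) (hz : ‖z - α m‖ ≤ d) (hs : 0 < s) :
    ‖⟪ψ, displacedParity (Function.update α m z) ψ⟫_ℂ - ⟪ψ, displacedParity α ψ⟫_ℂ‖ₑ ≤
      ENNReal.ofReal (2 * d * s + 4 * d * r) * ‖ψ‖ₑ ^ 2 +
        ENNReal.ofReal (2 * d / s) * numberForm m ψ := by
  have hr : 0 ≤ r := (norm_nonneg _).trans h1
  -- A nonzero coefficient keeps the bound infinite when `ψ` is outside the domain of `a_m`, where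
  -- the infimum is over the empty set.
  have hc0 : ENNReal.ofReal (2 * d / s) ≠ 0 := by
    rw [Ne, ENNReal.ofReal_eq_zero, not_le]
    positivity
  rw [numberForm, ENNReal.mul_iInf_of_ne hc0 ENNReal.ofReal_ne_top, ENNReal.add_iInf]
  refine le_iInf fun φ => ?_
  rw [ENNReal.mul_iInf_of_ne hc0 ENNReal.ofReal_ne_top, ENNReal.add_iInf]
  refine le_iInf fun hφ => ?_
  have h := norm_inner_displacedParity_update_sub_le hφ α z h1 h2
  rw [← ofReal_norm, ← ofReal_norm, ← ofReal_norm, ← ENNReal.ofReal_pow (norm_nonneg _),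
    ← ENNReal.ofReal_pow (norm_nonneg _), ← ENNReal.ofReal_mul (by positivity),
    ← ENNReal.ofReal_mul (by positivity), ← ENNReal.ofReal_add (by positivity) (by positivity)]
  refine ENNReal.ofReal_le_ofReal (h.trans ?_)
  have hyoung : 2 * (‖ψ‖ * ‖φ‖) ≤ s * ‖ψ‖ ^ 2 + ‖φ‖ ^ 2 / s := by
    have : 0 ≤ (s * ‖ψ‖ - ‖φ‖) ^ 2 / s := by positivity
    have e : (s * ‖ψ‖ - ‖φ‖) ^ 2 / s = s * ‖ψ‖ ^ 2 + ‖φ‖ ^ 2 / s - 2 * (‖ψ‖ * ‖φ‖) := by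
      field_simp
      ring
    linarith
  calc 4 * ‖z - α m‖ * (‖ψ‖ * ‖φ‖ + r * ‖ψ‖ ^ 2)
      ≤ 4 * d * (‖ψ‖ * ‖φ‖ + r * ‖ψ‖ ^ 2) := by gcongr
    _ = 2 * d * (2 * (‖ψ‖ * ‖φ‖)) + 4 * d * r * ‖ψ‖ ^ 2 := by ring
    _ ≤ 2 * d * (s * ‖ψ‖ ^ 2 + ‖φ‖ ^ 2 / s) + 4 * d * r * ‖ψ‖ ^ 2 := by gcongr
    _ = _ := by ring

/-- The modes are moved from `α` to `β` one at a time; all intermediate points keep every coordinate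
within radius `r`. -/
lemma enorm_inner_displacedParity_sub_le (ψ : Space ι) {α β : ι → ℂ} {r d s : ℝ}
    (h1 : ∀ m, ‖α m‖ ≤ r) (h2 : ∀ m, ‖β m‖ ≤ r) (hd : 0 < d) (hβ : ∀ m, ‖β m - α m‖ ≤ d)
    (hs : 0 < s) :
    ‖⟪ψ, displacedParity β ψ⟫_ℂ - ⟪ψ, displacedParity α ψ⟫_ℂ‖ₑ ≤
      ∑ m, (ENNReal.ofReal (2 * d * s + 4 * d * r) * ‖ψ‖ₑ ^ 2 +
        ENNReal.ofReal (2 * d / s) * numberForm m ψ) := by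
  have key : ∀ t : Finset ι,
      ‖⟪ψ, displacedParity (t.piecewise β α) ψ⟫_ℂ - ⟪ψ, displacedParity α ψ⟫_ℂ‖ₑ ≤
      ∑ m ∈ t, (ENNReal.ofReal (2 * d * s + 4 * d * r) * ‖ψ‖ₑ ^ 2 +
        ENNReal.ofReal (2 * d / s) * numberForm m ψ) := fun t => by
    induction t using Finset.induction_on with
    | empty => simp
    | insert m t hm ih =>
      rw [Finset.sum_insert hm, Finset.piecewise_insert]
      have hpm : t.piecewise β α m = α m := Finset.piecewise_eq_of_notMem _ _ _ hm
      have h := enorm_inner_displacedParity_update_sub_le ψ m (t.piecewise β α) (β m) (r := r)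
        (hpm ▸ h1 m) (h2 m) hd (hpm.symm ▸ hβ m) hs
      refine le_trans ?_ (add_le_add h ih)
      refine le_trans (le_of_eq ?_) (enorm_add_le _ _)
      rw [sub_add_sub_cancel]
  simpa using key Finset.univ

/-- Expectation values of displaced parities are Lipschitz in states of bounded energy. -/
lemma norm_trace_displacedParity_sub_le [Nonempty ι] {ρ : Op ι} (hρ : IsState ρ) {E : ℝ}
    (hE : 0 ≤ E) (henergy : totalEnergy ρ ≤ ENNReal.ofReal E) {α β : ι → ℂ} {r d : ℝ}
    (h1 : ∀ m, ‖α m‖ ≤ r) (h2 : ∀ m, ‖β m‖ ≤ r) (hd : 0 < d) (hβ : ∀ m, ‖β m - α m‖ ≤ d) :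
    ‖trace (ρ ∘L displacedParity β) - trace (ρ ∘L displacedParity α)‖ ≤
      4 * d * Real.sqrt (Fintype.card ι * E) + 4 * d * Fintype.card ι * r := by
  set M : ℝ := (Fintype.card ι : ℝ) with hM
  have hM0 : 0 < M := by
    rw [hM]
    exact_mod_cast Fintype.card_pos
  have hr : 0 ≤ r := (norm_nonneg _).trans (h1 (Classical.arbitrary ι))
  have hens := hρ.isEnsemble_sqrtOp
  set ψ := fun i => sqrtOp ρ (basis (Space ι) i)
  have hnorm : ∑' i, ‖ψ i‖ₑ ^ 2 = 1 := by
    have h1 := hens.hasSum_norm_sq hρ.2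
    have h2 := ENNReal.ofReal_tsum_of_nonneg (fun i => sq_nonneg _) h1.summable
    rw [h1.tsum_eq, ENNReal.ofReal_one] at h2
    rw [h2]
    refine tsum_congr fun i => ?_
    rw [ENNReal.ofReal_pow (norm_nonneg _), ofReal_norm]
  have key : ∀ s : ℝ, 0 < s → ‖trace (ρ ∘L displacedParity β) - trace (ρ ∘L displacedParity α)‖ ≤
      2 * d * (M * s + E / s) + 4 * d * M * r := fun s hs => by
    have hsum := (hens.hasSum_trace_comp (displacedParity β)).sub
      (hens.hasSum_trace_comp (displacedParity α))
    rw [← hsum.tsum_eq, ← ENNReal.ofReal_le_ofReal_iff (by positivity), ofReal_norm]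
    calc _ ≤ ∑' i, ‖⟪ψ i, displacedParity β (ψ i)⟫_ℂ - ⟪ψ i, displacedParity α (ψ i)⟫_ℂ‖ₑ :=
          enorm_tsum_le_tsum_enorm
      _ ≤ ∑' i, ∑ m, (ENNReal.ofReal (2 * d * s + 4 * d * r) * ‖ψ i‖ₑ ^ 2 +
            ENNReal.ofReal (2 * d / s) * numberForm m (ψ i)) :=
          ENNReal.tsum_le_tsum fun i => enorm_inner_displacedParity_sub_le (ψ i) h1 h2 hd hβ hs
      _ = ∑ m : ι, (ENNReal.ofReal (2 * d * s + 4 * d * r) +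
            ENNReal.ofReal (2 * d / s) * meanNumber ρ m) := by
          rw [Summable.tsum_finsetSum fun _ _ => ENNReal.summable]
          refine Finset.sum_congr rfl fun m _ => ?_
          rw [ENNReal.tsum_add, ENNReal.tsum_mul_left, ENNReal.tsum_mul_left, hnorm, mul_one]
          rfl
      _ = ENNReal.ofReal M * ENNReal.ofReal (2 * d * s + 4 * d * r) +
            ENNReal.ofReal (2 * d / s) * totalEnergy ρ := by
          rw [Finset.sum_add_distrib, ← Finset.mul_sum, Finset.sum_const, Finset.card_univ,
            nsmul_eq_mul, hM, ENNReal.ofReal_natCast]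
          rfl
      _ ≤ ENNReal.ofReal M * ENNReal.ofReal (2 * d * s + 4 * d * r) +
            ENNReal.ofReal (2 * d / s) * ENNReal.ofReal E := by gcongr
      _ = _ := by
          rw [← ENNReal.ofReal_mul hM0.le, ← ENNReal.ofReal_mul (by positivity),
            ← ENNReal.ofReal_add (by positivity) (by positivity)]
          congr 1
          ring
  -- `M * s + E / s` is minimal at `s = √(E / M)`. For `E = 0` this degenerates, and `s` is sent to
  -- zero instead.
  rcases hE.eq_or_lt with rfl | hE
  · rw [mul_zero, Real.sqrt_zero, mul_zero, zero_add]
    refine le_of_forall_pos_le_add fun ε hε => ?_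
    have h := key (ε / (2 * d * M)) (by positivity)
    rw [zero_div, add_zero, ← mul_assoc, mul_div_cancel₀ _ (by positivity)] at h
    linarith
  · have h := key (Real.sqrt (E / M)) (Real.sqrt_pos.2 (by positivity))
    have e1 : M * Real.sqrt (E / M) = Real.sqrt (M * E) := by
      rw [Real.sqrt_div' _ hM0.le, Real.sqrt_mul hM0.le, mul_div_assoc', div_eq_iff
        (Real.sqrt_pos.2 hM0).ne']
      linear_combination Real.sqrt E * (-(Real.mul_self_sqrt hM0.le))
    have e2 : E / Real.sqrt (E / M) = Real.sqrt (M * E) := by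
      rw [← e1, div_eq_iff (Real.sqrt_pos.2 (by positivity)).ne', mul_assoc,
        Real.mul_self_sqrt (by positivity), mul_div_cancel₀ _ hM0.ne']
    rw [e1, e2] at h
    linarith

end Energy

/-! ### Discretisation -/

section Grid

/-- The square cell of side `Δ` centred at the grid point `n`. -/
def gridCell (Δ : ℝ) (n : ℤ × ℤ) : Set (ℝ × ℝ) :=
  Metric.ball (n.1 * Δ) (Δ / 2) ×ˢ Metric.ball (n.2 * Δ) (Δ / 2)

lemma measurableSet_gridCell (Δ : ℝ) (n : ℤ × ℤ) : MeasurableSet (gridCell Δ n) :=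
  measurableSet_ball.prod measurableSet_ball

lemma volume_gridCell {Δ : ℝ} (hΔ : 0 < Δ) (n : ℤ × ℤ) :
    volume (gridCell Δ n) = ENNReal.ofReal (Δ ^ 2) := by
  rw [gridCell, Measure.volume_eq_prod, Measure.prod_prod, Real.volume_ball, Real.volume_ball,
    ← ENNReal.ofReal_mul (by positivity)]
  congr 1
  ring

lemma eq_of_mem_ball_of_mem_ball {Δ x : ℝ} (hΔ : 0 < Δ) {a b : ℤ}
    (ha : x ∈ Metric.ball (a * Δ) (Δ / 2)) (hb : x ∈ Metric.ball (b * Δ) (Δ / 2)) : a = b := by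
  rw [Metric.mem_ball, Real.dist_eq, abs_lt] at ha hb
  have h1 : ((a : ℝ) - b) * Δ < 1 * Δ := by linarith
  have h2 : ((b : ℝ) - a) * Δ < 1 * Δ := by linarith
  have h3 := lt_of_mul_lt_mul_right h1 hΔ.le
  have h4 := lt_of_mul_lt_mul_right h2 hΔ.le
  have h5 : a - b < 1 := by exact_mod_cast h3
  have h6 : b - a < 1 := by exact_mod_cast h4
  omega

/-- Open cells miss only their boundaries. An upper bound on the grid sum needs disjointness and the
full area `Δ ^ 2`, not a covering of the plane. -/
lemma disjoint_gridCell {Δ : ℝ} (hΔ : 0 < Δ) {n k : ℤ × ℤ} (h : n ≠ k) :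
    Disjoint (gridCell Δ n) (gridCell Δ k) := by
  refine Set.disjoint_left.2 fun x hx hy => h (Prod.ext ?_ ?_)
  · exact eq_of_mem_ball_of_mem_ball hΔ hx.1 hy.1
  · exact eq_of_mem_ball_of_mem_ball hΔ hx.2 hy.2

variable {M : ℕ}

lemma norm_gridPoint (Δ : ℝ) (hΔ : 0 < Δ) (n : ℤ × ℤ) (m : Fin M) :
    ‖gridPoint M Δ n m‖ = Real.sqrt ((n.1 : ℝ) ^ 2 + (n.2 : ℝ) ^ 2) * Δ := by
  have h : ((n.1 : ℂ) + Complex.I * (n.2 : ℂ)) = ⟨(n.1 : ℝ), (n.2 : ℝ)⟩ := by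
    apply Complex.ext <;> simp
  rw [gridPoint, norm_mul, Complex.norm_real, Real.norm_of_nonneg hΔ.le, h, Complex.norm_def,
    Complex.normSq_mk, pow_two, pow_two]

lemma norm_diag_sub_gridPoint_le {Δ : ℝ} (hΔ : 0 < Δ) {n : ℤ × ℤ} {p : ℝ × ℝ}
    (hp : p ∈ gridCell Δ n) (m : Fin M) :
    ‖diag (Fin M) p m - gridPoint M Δ n m‖ ≤ Δ / Real.sqrt 2 := by
  obtain ⟨h1, h2⟩ := hp
  rw [Metric.mem_ball, Real.dist_eq] at h1 h2
  have h : diag (Fin M) p m - gridPoint M Δ n m = ⟨p.1 - n.1 * Δ, p.2 - n.2 * Δ⟩ := by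
    apply Complex.ext <;> simp [diag, gridPoint]
  rw [h, Complex.norm_def, Complex.normSq_mk]
  refine Real.sqrt_le_iff.2 ⟨by positivity, ?_⟩
  rw [div_pow, Real.sq_sqrt (by norm_num)]
  have h3 := sq_lt_sq' (abs_lt.1 h1).1 (abs_lt.1 h1).2
  have h4 := sq_lt_sq' (abs_lt.1 h2).1 (abs_lt.1 h2).2
  nlinarith

lemma ofReal_trace_gridPoint_le (hM : 0 < M) {ρ : Op (Fin M)} (hρ : IsState ρ) {E : ℝ}
    (hE : 0 ≤ E) (henergy : totalEnergy ρ ≤ ENNReal.ofReal E) {Δ : ℝ} (hΔ : 0 < Δ) (n : ℤ × ℤ) :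
    ENNReal.ofReal (Δ ^ 2 * ‖trace (ρ ∘L displacedParity (gridPoint M Δ n))‖) ≤
      (∫⁻ p in gridCell Δ n, ‖trace (ρ ∘L displacedParity (diag (Fin M) p))‖ₑ) +
      ENNReal.ofReal (2 * Δ ^ 3 * Real.sqrt (2 * M * E) +
        2 * M * Δ ^ 4 * (1 + Real.sqrt (2 * ((n.1 : ℝ) ^ 2 + (n.2 : ℝ) ^ 2)))) := by
  have : Nonempty (Fin M) := ⟨⟨0, hM⟩⟩
  have h22 : Real.sqrt 2 * Real.sqrt 2 = 2 := Real.mul_self_sqrt (by norm_num)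
  have hs2 : Real.sqrt 2 ≠ 0 := by simp
  -- `d` is half the diagonal of the cell, and `r` bounds the modulus of every point in it. With
  -- these values `Δ ^ 2 * B` is exactly the summand of `δI`.
  set d := Δ / Real.sqrt 2
  set r := Real.sqrt ((n.1 : ℝ) ^ 2 + (n.2 : ℝ) ^ 2) * Δ + d
  set B := 4 * d * Real.sqrt (M * E) + 4 * d * M * r
  have hd : 0 < d := by positivity
  have hB : Δ ^ 2 * B = 2 * Δ ^ 3 * Real.sqrt (2 * M * E) +
        2 * M * Δ ^ 4 * (1 + Real.sqrt (2 * ((n.1 : ℝ) ^ 2 + (n.2 : ℝ) ^ 2))) := by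
    rw [mul_assoc 2 (M : ℝ) E, Real.sqrt_mul zero_le_two, Real.sqrt_mul zero_le_two]
    have hd2 : d = Δ * Real.sqrt 2 / 2 := by
      simp only [d]
      field_simp
      linear_combination -h22
    simp only [B, r, hd2]
    linear_combination M * Δ ^ 4 * h22
  have hpoint : ∀ p ∈ gridCell Δ n, ‖trace (ρ ∘L displacedParity (gridPoint M Δ n))‖ₑ ≤
      ‖trace (ρ ∘L displacedParity (diag (Fin M) p))‖ₑ + ENNReal.ofReal B := fun p hp => by
    have hdist := norm_diag_sub_gridPoint_le (M := M) hΔ hp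
    have h := norm_trace_displacedParity_sub_le hρ hE henergy (β := gridPoint M Δ n)
      (α := diag (Fin M) p) (r := r) (fun m => by
        have := norm_le_norm_add_norm_sub' (diag (Fin M) p m) (gridPoint M Δ n m)
        rw [norm_gridPoint Δ hΔ] at this
        exact this.trans (add_le_add_right (hdist m) _))
      (fun m => by rw [norm_gridPoint Δ hΔ]; exact le_add_of_nonneg_right hd.le) hd
      (fun m => by rw [norm_sub_rev]; exact hdist m)
    rw [Fintype.card_fin] at h
    rw [← ofReal_norm, ← ofReal_norm, ← ENNReal.ofReal_add (norm_nonneg _) (by positivity)]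
    refine ENNReal.ofReal_le_ofReal ?_
    have := norm_le_norm_add_norm_sub' (trace (ρ ∘L displacedParity (gridPoint M Δ n)))
      (trace (ρ ∘L displacedParity (diag (Fin M) p)))
    linarith
  calc _ = ∫⁻ _ in gridCell Δ n, ‖trace (ρ ∘L displacedParity (gridPoint M Δ n))‖ₑ := by
        rw [setLIntegral_const, volume_gridCell hΔ, mul_comm, ENNReal.ofReal_mul (norm_nonneg _),
          ofReal_norm]
    _ ≤ ∫⁻ p in gridCell Δ n, (‖trace (ρ ∘L displacedParity (diag (Fin M) p))‖ₑ +
          ENNReal.ofReal B) := setLIntegral_mono' (measurableSet_gridCell Δ n) hpoint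
    _ = _ := by
        rw [lintegral_add_right _ measurable_const, setLIntegral_const, volume_gridCell hΔ,
          mul_comm (ENNReal.ofReal B), ← ENNReal.ofReal_mul (by positivity), hB]

/-- The discretised integral exceeds the integral by at most the error term. -/
lemma discreteIntegral_le (hM : 0 < M) {ρ : Op (Fin M)} (hρ : IsState ρ) {E : ℝ}
    (hE : 0 ≤ E) (henergy : totalEnergy ρ ≤ ENNReal.ofReal E) {Δ : ℝ} (hΔ : 0 < Δ)
    (S : Set (ℤ × ℤ)) :
    discreteIntegral ρ Δ S ≤
      (∫⁻ p : ℝ × ℝ, ‖trace (ρ ∘L displacedParity (diag (Fin M) p))‖ₑ) +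
        discreteError M Δ S E := by
  refine (ENNReal.tsum_le_tsum fun n : S =>
    ofReal_trace_gridPoint_le hM hρ hE henergy hΔ (n : ℤ × ℤ)).trans ?_
  rw [ENNReal.tsum_add]
  refine add_le_add ?_ le_rfl
  rw [← lintegral_iUnion (fun n : S => measurableSet_gridCell Δ (n : ℤ × ℤ))
    (fun n k h => disjoint_gridCell hΔ (Subtype.coe_injective.ne h))]
  exact setLIntegral_le_lintegral _ _

end Grid

end CVSystem

end

theorem mainTheorem2 (M : ℕ) (hM : 2 ≤ M) (ρ : CVSystem.Op (Fin M)) (hρ : CVSystem.IsState ρ)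
    (E : ℝ) (hE : 0 ≤ E) (henergy : CVSystem.totalEnergy ρ ≤ ENNReal.ofReal E)
    (Δ : ℝ) (hΔ : 0 < Δ) (S : Set (ℤ × ℤ))
    (hI : ENNReal.ofReal (Real.pi / (4 * Real.sqrt ((M : ℝ) - 1))) <
      CVSystem.discreteIntegral ρ Δ S - CVSystem.discreteError M Δ S E) :
    CVSystem.IsGME ρ := by
  refine ⟨hρ, fun h => hI.not_ge ?_⟩
  have h1 := h.lintegral_trace_le hρ
  rw [Fintype.card_fin] at h1
  -- The subtraction is truncated: an infinite error term would make the difference zero, so `hI`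
  -- itself rules it out.
  exact (tsub_le_iff_right.2
    (CVSystem.discreteIntegral_le (by omega) hρ hE henergy hΔ S)).trans h1
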